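/- For $\alpha>0$ and $\mathbf x=(x_1,x_2)\in[0,1)^2$, call a Lebesgue measurable set $S\subset[0,1)^2$ with measure $\lambda(S)$ a *bounded remainder set* for the continuous rotation $t\mapsto(\{x_1+t\},\{x_2+\alpha t\})$ with slope $\alpha$ and starting point $\mathbf x$ if there is a constant $C$ such that $$\Big|\int_0^T \chi_S\big(\{x_1+t\},\{x_2+\alpha t\}\big)\,dt - T\lambda(S)\Big|\le C\quad\text{for all } T>0 .$$ A *polygon* is the region enclosed by a simple closed polygonal chain, together with any part of that chain. **Theorem.** For almost all $\alpha>0$ (with respect to Lebesgue measure), for every $\mathbf x\in[0,1)^2$, every polygon $S\subset[0,1)^2$ with no edge of slope $\alpha$ is a bounded remainder set for the continuous rotation with slope $\alpha$ and starting point $\mathbf x$. Moreover, the same conclusion (for every $\mathbf x$ and every such $S$) holds for each irrational $\alpha>0$ with continued fraction expansion $\alpha=[a_0;a_1,a_2,\dots]$ and convergent denominators $(q_l)_{l\ge0}$ for which there is a constant $C$, independent of $s$, with $$\sum_{l=0}^{s}\frac{a_{l+1}}{q_l^{1/2}}\sum_{k=1}^{l+1}a_k<C\quad\text{for all } s\ge0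 .$$ -/

import Mathlib

open Set MeasureTheory

noncomputable section

/-- The half-open unit square `[0,1)²`. -/
def unitSquare : Set (ℝ × ℝ) := Ico (0 : ℝ) 1 ×ˢ Ico (0 : ℝ) 1

/-- The two-dimensional continuous rotation `t ↦ ({x₁ + t}, {x₂ + α t})`. -/
def contRotation (α : ℝ) (x : ℝ × ℝ) (t : ℝ) : ℝ × ℝ :=
  (Int.fract (x.1 + t), Int.fract (x.2 + α * t))

/-- The distributional error `Δ_T(S, α, x)`. -/
def distributionalError (S : Set (ℝ × ℝ)) (α : ℝ) (x : ℝ × ℝ) (T : ℝ) : ℝ :=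
  (∫ t in (0 : ℝ)..T, S.indicator (fun _ => (1 : ℝ)) (contRotation α x t)) - T * volume.real S

/-- `S` is a bounded remainder set for the continuous rotation with slope `α` starting at `x`.
The first two clauses say that `S` is Lebesgue measurable and that the time spent in `S` up to
any time `T` is given by a genuine (integrable) integral. -/
structure IsBoundedRemainderSet (S : Set (ℝ × ℝ)) (α : ℝ) (x : ℝ × ℝ) : Prop where
  nullMeasurableSet : NullMeasurableSet S (volume : Measure (ℝ × ℝ))
  intervalIntegrable : ∀ T : ℝ, 0 < T →
    IntervalIntegrable (fun t => S.indicator (fun _ => (1 : ℝ)) (contRotation α x t)) volume 0 T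
  bounded : ∃ C : ℝ, ∀ T : ℝ, 0 < T → |distributionalError S α x T| ≤ C

/-- The closed polygonal chain of `P` is a simple closed curve: its half-open edges
are traversed injectively and do not meet each other. -/
def PolygonIsSimple {n : ℕ} (P : Polygon (ℝ × ℝ) n) : Prop :=
  3 ≤ n ∧ ∀ (i j : Fin n) (s t : ℝ), s ∈ Ico (0 : ℝ) 1 → t ∈ Ico (0 : ℝ) 1 →
    P.edgePath ℝ i s = P.edgePath ℝ j t → i = j ∧ s = t

/-- The open region enclosed by the polygonal chain: the points off the chain whose connected
component in the complement of the chain is bounded. -/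
def polygonInside {n : ℕ} (P : Polygon (ℝ × ℝ) n) : Set (ℝ × ℝ) :=
  {p | p ∉ P.boundary ℝ ∧ Bornology.IsBounded (connectedComponentIn (P.boundary ℝ)ᶜ p)}

/-- `S` is a polygonal region with boundary chain `P`: `P` is a simple closed polygonal chain, and
`S` is the region enclosed by `P`, together with an arbitrary part of the chain itself
(so closed, open and half-open polygons are all included). -/
def IsPolygonalRegion {n : ℕ} (P : Polygon (ℝ × ℝ) n) (S : Set (ℝ × ℝ)) : Prop :=
  PolygonIsSimple P ∧ polygonInside P ⊆ S ∧ S ⊆ polygonInside P ∪ P.boundary ℝ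

/-- The line through the two distinct points `p`, `q` is not vertical and has slope `α`. -/
def SegmentHasSlope (p q : ℝ × ℝ) (α : ℝ) : Prop :=
  p.1 ≠ q.1 ∧ q.2 - p.2 = α * (q.1 - p.1)

/-- `S` is a polygon in the unit square none of whose edges has slope `α`. -/
def IsPolygonWithoutEdgeOfSlope (S : Set (ℝ × ℝ)) (α : ℝ) : Prop :=
  S ⊆ unitSquare ∧ ∃ (n : ℕ) (P : Polygon (ℝ × ℝ) n), IsPolygonalRegion P S ∧
    ∀ i : Fin n, ¬ SegmentHasSlope (P i) (P (finRotate n i)) α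

/-- The `k`-th partial quotient `a_k` of `α = [a₀; a₁, a₂, …]` (`0` if the expansion stops
before; this does not happen for irrational `α`). -/
def partialQuotient (α : ℝ) : ℕ → ℝ
  | 0 => (GenContFract.of α).h
  | k + 1 => ((GenContFract.of α).partDens.get? k).getD 0

/-- The denominator `q_l` of the `l`-th convergent of `α`. -/
def convergentDenom (α : ℝ) (l : ℕ) : ℝ := (GenContFract.of α).dens l

/-- The partial sums `∑_{l=0}^{s} a_{l+1} q_l^{-1/2} ∑_{k=1}^{l+1} a_k` stay below a constant `C`
that does not depend on `s`. -/
def PartialQuotientCondition (α : ℝ) : Prop :=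
  ∃ C : ℝ, ∀ s : ℕ,
    ∑ l ∈ Finset.range (s + 1), partialQuotient α (l + 1) / (convergentDenom α l) ^ (1 / 2 : ℝ) *
      ∑ k ∈ Finset.Icc 1 (l + 1), partialQuotient α k < C

end

open Set MeasureTheory Filter Topology

noncomputable section

/-! Cut the flow at the vertical side of the torus. The time spent in the open inside `U` of the
polygon between consecutive crossings is a function `returnTime` of the crossing height, and
successive heights differ by the rotation by `α`. So it suffices that Birkhoff sums of this function
stay within bounded distance of `N * volume.real U`, uniformly in the starting height.

The return time is a finite sum of integer translates of `chordLength`. No edge has slope `α`, so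
each line of that slope meets the chain in finitely many points. Hence the chord length is
continuous in the intercept, and it is affine away from the intercepts of the vertices: between
consecutive crossings the line is wholly inside or wholly outside. For this it is enough that `U` is
a union of components of the complement of the chain; the Jordan curve theorem plays no role.

A continuous, `1`-periodic, piecewise affine function is a constant plus a linear combination of
translates of `{y}(1 - {y})` (`exists_hasBoundedDiscrepancy`). The Fourier coefficients of this
parabola are of order `1/m²`, and a geometric sum bounds the Birkhoff sum of the `m`-th harmonic by
`1/‖mα‖`. So everything reduces to the convergence of `∑ 1/(m²‖mα‖)`, where `‖·‖` is the distance to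
the nearest integer.

That series converges if `‖mα‖ ≥ c m^{-3/2}` (`IsDiophantine.summable`). The bound holds for almost
every `α`, and it follows from the partial quotient condition, which forces `a_{l+1} ≤ C q_l^{1/2}`.
-/

/-! ### The Diophantine condition for almost every slope -/

/-- `α` is Diophantine with exponent `3/2`: `‖mα‖ ≥ c / m^{3/2}` for all `m ≥ 1`. -/
def IsDiophantine (α : ℝ) : Prop :=
  ∃ c : ℝ, 0 < c ∧ ∀ m : ℕ, 1 ≤ m → ∀ n : ℤ, c / (m : ℝ) ^ (3 / 2 : ℝ) ≤ |m * α - n|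

theorem exists_pos_le_of_pos (δ : ℕ → ℝ) (hδ : ∀ m, 1 ≤ m → 0 < δ m) (N : ℕ) :
    ∃ c : ℝ, 0 < c ∧ c ≤ 1 ∧ ∀ m, 1 ≤ m → m ≤ N → c ≤ δ m := by
  induction N with
  | zero => exact ⟨1, one_pos, le_rfl, fun m h1 h2 => by omega⟩
  | succ N ih =>
    obtain ⟨c, hc, hc1, h⟩ := ih
    refine ⟨min c (δ (N + 1)), lt_min hc (hδ _ (by omega)), (min_le_left _ _).trans hc1, ?_⟩
    intro m h1 h2
    rcases Nat.lt_or_ge N m with h3 | h3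
    · obtain rfl : m = N + 1 := by omega
      exact min_le_right _ _
    · exact (min_le_left _ _).trans (h m h1 h3)

theorem rpow_five_halves {x : ℝ} (hx : 0 < x) : x ^ (5 / 2 : ℝ) = x * x ^ (3 / 2 : ℝ) := by
  rw [show (5 / 2 : ℝ) = 1 + 3 / 2 by norm_num, Real.rpow_add hx, Real.rpow_one]

/-- The finitely many `m` below the threshold only cost a smaller constant, since irrationality
keeps each `‖mα‖` positive. -/
theorem isDiophantine_of_eventually {α : ℝ} (hα : Irrational α) {N : ℕ}
    (h : ∀ m : ℕ, N ≤ m → ∀ n : ℤ, 1 / (m : ℝ) ^ (5 / 2 : ℝ) ≤ |α - n / m|) :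
    IsDiophantine α := by
  obtain ⟨c, hc, hc1, hcN⟩ := exists_pos_le_of_pos (fun m => |m * α - round (m * α)|)
    (fun m hm => by
      have : Irrational (m * α) := hα.natCast_mul (by omega)
      exact abs_pos.2 (sub_ne_zero.2 (this.ne_int _))) N
  refine ⟨c, hc, fun m hm n => ?_⟩
  have hm0 : (1 : ℝ) ≤ m := by exact_mod_cast hm
  have hpos : (0 : ℝ) < m := by linarith
  have hp1 : 1 ≤ (m : ℝ) ^ (3 / 2 : ℝ) := Real.one_le_rpow hm0 (by norm_num)
  rcases le_total m N with hmN | hmN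
  · calc c / (m : ℝ) ^ (3 / 2 : ℝ) ≤ c := div_le_self hc.le hp1
      _ ≤ _ := hcN m hm hmN
      _ ≤ _ := round_le _ _
  · have h1 := h m hmN n
    have h2 : |m * α - n| = m * |α - n / m| := by
      rw [← abs_of_pos hpos, ← abs_mul, abs_of_pos hpos]
      congr 1
      field_simp
    rw [h2]
    calc c / (m : ℝ) ^ (3 / 2 : ℝ) ≤ 1 / (m : ℝ) ^ (3 / 2 : ℝ) := by gcongr
      _ = m * (1 / (m : ℝ) ^ (5 / 2 : ℝ)) := by
        rw [rpow_five_halves hpos]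
        field_simp
      _ ≤ _ := by gcongr

theorem ae_isDiophantine : ∀ᵐ α : ℝ, IsDiophantine α := by
  have hirr : ∀ᵐ α : ℝ, Irrational α := (countable_range ((↑) : ℚ → ℝ)).ae_notMem volume
  filter_upwards [ae_not_liouvilleWith, hirr] with α hα hi
  -- Exponent `5/2` for `|α - n/m|` is exponent `3/2` for `|mα - n|`.
  have h := hα (5 / 2) (by norm_num)
  simp only [LiouvilleWith, not_exists, Filter.not_frequently, not_and, not_lt] at h
  obtain ⟨N, hN⟩ := Filter.eventually_atTop.1 (h 1)
  refine isDiophantine_of_eventually hi (N := N) fun m hm n => hN m hm n ?_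
  have := hi.ne_rat (n / m)
  push_cast at this
  exact this

/-! ### Continued fractions: the Diophantine condition from the partial quotients -/

open GenContFract

theorem exists_int_num_den (α : ℝ) (n : ℕ) :
    (∃ A B : ℤ, (GenContFract.of α).nums n = A ∧ (GenContFract.of α).dens n = B) := by
  -- The two-step recurrence lives on `contsAux`, whose index is ahead by one of that of `nums` and
  -- `dens`.
  have key : ∀ n, ∃ A B : ℤ, ((GenContFract.of α).contsAux n).a = A ∧
      ((GenContFract.of α).contsAux n).b = B := by
    intro n
    induction n using Nat.strong_induction_on with
    | _ n ih =>
      match n with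
      | 0 => exact ⟨1, 0, by simp [GenContFract.contsAux]⟩
      | 1 => exact ⟨⌊α⌋, 1, by simp [GenContFract.contsAux]⟩
      | n + 2 =>
        obtain ⟨A, B, hA, hB⟩ := ih (n + 1) (by omega)
        obtain ⟨A', B', hA', hB'⟩ := ih n (by omega)
        rcases h : (GenContFract.of α).s.get? n with _ | gp
        · refine ⟨A, B, ?_⟩
          rw [contsAux_stable_step_of_terminated h]
          exact ⟨hA, hB⟩
        · obtain ⟨ha, z, hz⟩ := of_partNum_eq_one_and_exists_int_partDen_eq h
          rw [contsAux_recurrence h rfl rfl]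
          refine ⟨z * A + A', z * B + B', ?_⟩
          simp [ha, hz, hA, hB, hA', hB']
  exact key (n + 1)

theorem not_terminatedAt_of_irrational {α : ℝ} (hα : Irrational α) (n : ℕ) :
    ¬(GenContFract.of α).TerminatedAt n := by
  intro h
  obtain ⟨q, hq⟩ := (terminates_iff_rat α).1 ⟨n, h⟩
  exact hα ⟨q, hq.symm⟩

/-- The determinant identity is a Bézout relation, so the convergent is already in lowest terms. -/
theorem den_eq_of_convs_eq {α : ℝ} (hα : Irrational α) {n : ℕ} {q : ℚ}
    (h : (GenContFract.of α).convs n = q) : (GenContFract.of α).dens n = q.den := by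
  obtain ⟨A, B, hA, hB⟩ := exists_int_num_den α n
  obtain ⟨A', B', hA', hB'⟩ := exists_int_num_den α (n + 1)
  have hdet := (SimpContFract.of α).determinant (n := n) (not_terminatedAt_of_irrational hα n)
  have e : (SimpContFract.of α : GenContFract ℝ) = GenContFract.of α := rfl
  rw [e, hA, hB, hA', hB'] at hdet
  have hdet' : A * B' - B * A' = (-1) ^ (n + 1) := by exact_mod_cast hdet
  have hcop : IsCoprime A B := by
    refine ⟨(-1) ^ (n + 1) * B', -((-1) ^ (n + 1) * A'), ?_⟩
    have h1 : ((-1 : ℤ) ^ (n + 1)) * (-1) ^ (n + 1) = 1 := by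
      rw [← mul_pow]; simp
    linear_combination (-1) ^ (n + 1) * hdet' + h1
  have hBpos : 0 < B := by
    have h1 := succ_nth_fib_le_of_nth_den (v := α) (n := n)
      (Or.inr (not_terminatedAt_of_irrational hα _))
    rw [hB] at h1
    have h2 : (1 : ℝ) ≤ Nat.fib (n + 1) := by exact_mod_cast Nat.fib_pos.2 (by omega)
    exact_mod_cast lt_of_lt_of_le one_pos (h2.trans h1)
  rw [conv_eq_num_div_den, hA, hB] at h
  have hq : q = A / B := by exact_mod_cast h.symm
  have := Rat.den_div_eq_of_coprime hBpos (Int.isCoprime_iff_nat_coprime.1 hcop)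
  rw [← hq] at this
  rw [hB, ← this]
  simp

theorem one_le_dens {α : ℝ} (hα : Irrational α) (n : ℕ) : 1 ≤ (GenContFract.of α).dens n := by
  have h1 := succ_nth_fib_le_of_nth_den (v := α) (n := n)
    (Or.inr (not_terminatedAt_of_irrational hα _))
  have h2 : (1 : ℝ) ≤ Nat.fib (n + 1) := by exact_mod_cast Nat.fib_pos.2 (by omega)
  exact h2.trans h1

theorem one_le_partialQuotient {α : ℝ} (hα : Irrational α) (n : ℕ) :
    1 ≤ partialQuotient α (n + 1) := by
  have h := not_terminatedAt_of_irrational hα n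
  rw [terminatedAt_iff_partDen_none] at h
  obtain ⟨b, hb⟩ := Option.ne_none_iff_exists'.1 h
  simp only [partialQuotient, hb, Option.getD_some]
  exact of_one_le_get?_partDen hb

/-- The exact error is `1/(q_n (ξ q_n + q_{n-1}))` with complete quotient `ξ < a_{n+1} + 1` and
`q_{n-1} ≤ q_n`. -/
theorem abs_sub_convs_ge {α : ℝ} (hα : Irrational α) (n : ℕ) :
    1 / ((GenContFract.of α).dens n ^ 2 * (partialQuotient α (n + 1) + 2)) ≤
      |α - (GenContFract.of α).convs n| := by
  obtain ⟨gp, hgp⟩ := Option.ne_none_iff_exists'.1 (not_terminatedAt_of_irrational hα n)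
  obtain ⟨ifs, hs, hsb⟩ := IntFractPair.exists_succ_get?_stream_of_gcf_of_get?_eq_some hgp
  obtain ⟨ifp, hp, hfr, hof⟩ := IntFractPair.succ_nth_stream_eq_some_iff.1 hs
  have heq := sub_convs_eq hp
  simp only [hfr, if_false] at heq
  have hpq : partialQuotient α (n + 1) = ifs.b := by
    simp only [partialQuotient, partDen_eq_s_b hgp, Option.getD_some, hsb]
  have hinv : ifp.fr⁻¹ < ifs.b + 1 := by
    rw [← hof]
    exact Int.lt_floor_add_one _
  have hfrpos : 0 < ifp.fr := hfr.symm.lt_of_le (IntFractPair.nth_stream_fr_nonneg hp)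
  have hB : ((GenContFract.of α).contsAux (n + 1)).b = (GenContFract.of α).dens n := rfl
  have hB1 := one_le_dens hα n
  have hpB0 : 0 ≤ ((GenContFract.of α).contsAux n).b := zero_le_of_contsAux_b
  have hpB : ((GenContFract.of α).contsAux n).b ≤ (GenContFract.of α).dens n := by
    cases n with
    | zero => simp [GenContFract.contsAux]
    | succ n => exact of_den_mono
  have hfi : 0 < ifp.fr⁻¹ := inv_pos.2 hfrpos
  rw [heq, hB, abs_div, abs_neg_one_pow, abs_of_nonneg (by positivity), hpq]
  have hpos : 0 < (GenContFract.of α).dens n := by linarith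
  refine one_div_le_one_div_of_le (by positivity) ?_
  nlinarith [mul_le_mul_of_nonneg_left hinv.le (mul_pos hpos hpos).le,
    mul_le_mul_of_nonneg_left hpB hpos.le]

/-- All terms are nonnegative and each inner sum is at least `a_1 ≥ 1`, so a single term already
gives the bound. -/
theorem partialQuotient_le_of_condition {α : ℝ} (hα : Irrational α)
    (h : PartialQuotientCondition α) :
    ∃ C : ℝ, 0 < C ∧ ∀ l, partialQuotient α (l + 1) ≤ C * convergentDenom α l ^ (1 / 2 : ℝ) := by
  obtain ⟨C, hC⟩ := h
  have hq : ∀ l, 0 < convergentDenom α l ^ (1 / 2 : ℝ) := fun l =>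
    Real.rpow_pos_of_pos (lt_of_lt_of_le one_pos (one_le_dens hα l)) _
  have ha : ∀ l, 0 ≤ partialQuotient α (l + 1) := fun l =>
    zero_le_one.trans (one_le_partialQuotient hα l)
  have hsum : ∀ l, 1 ≤ ∑ k ∈ Finset.Icc 1 (l + 1), partialQuotient α k := by
    intro l
    refine (one_le_partialQuotient hα 0).trans ?_
    refine Finset.single_le_sum (f := fun k => partialQuotient α k) (fun k hk => ?_) (by simp)
    obtain ⟨j, rfl⟩ : ∃ j, k = j + 1 := ⟨k - 1, by have := (Finset.mem_Icc.1 hk).1; omega⟩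
    exact ha j
  have key : ∀ l, partialQuotient α (l + 1) / convergentDenom α l ^ (1 / 2 : ℝ) ≤ C := by
    intro l
    calc _ ≤ partialQuotient α (l + 1) / convergentDenom α l ^ (1 / 2 : ℝ) *
        ∑ k ∈ Finset.Icc 1 (l + 1), partialQuotient α k :=
          le_mul_of_one_le_right (div_nonneg (ha l) (hq l).le) (hsum l)
      _ ≤ _ := Finset.single_le_sum (f := fun l => partialQuotient α (l + 1) /
          convergentDenom α l ^ (1 / 2 : ℝ) * ∑ k ∈ Finset.Icc 1 (l + 1), partialQuotient α k)
          (fun l _ => mul_nonneg (div_nonneg (ha l) (hq l).le) (zero_le_one.trans (hsum l)))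
          (Finset.self_mem_range_succ l)
      _ ≤ C := (hC l).le
  refine ⟨max C 1, by positivity, fun l => ?_⟩
  rw [← div_le_iff₀ (hq l)]
  exact (key l).trans (le_max_left _ _)

theorem isDiophantine_of_partialQuotientCondition {α : ℝ} (hα : Irrational α)
    (h : PartialQuotientCondition α) : IsDiophantine α := by
  obtain ⟨C, hC, hle⟩ := partialQuotient_le_of_condition hα h
  refine ⟨1 / (C + 2), by positivity, fun m hm n => ?_⟩
  have hm0 : (1 : ℝ) ≤ m := by exact_mod_cast hm
  have hpos : (0 : ℝ) < m := by linarith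
  set q : ℚ := n / m with hq
  have hdm : (q.den : ℝ) ≤ m := by
    have h1 : (q.den : ℤ) ∣ m := by
      have := Rat.den_dvd n m
      rw [Rat.divInt_eq_div] at this
      simpa [hq] using this
    exact_mod_cast Nat.le_of_dvd (by omega) (Int.natCast_dvd_natCast.1 h1)
  have hd1 : (1 : ℝ) ≤ q.den := by exact_mod_cast q.den_pos
  have hd0 : (0 : ℝ) < q.den := by linarith
  have h2 : |m * α - n| = m * |α - q| := by
    rw [← abs_of_pos hpos, ← abs_mul, abs_of_pos hpos, hq]
    congr 1
    push_cast
    field_simp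
  have key : 1 / ((C + 2) * (q.den : ℝ) ^ (5 / 2 : ℝ)) ≤ |α - q| := by
    -- Legendre's criterion: a fraction this close is a convergent. Otherwise the failure of
    -- closeness is itself a stronger bound.
    rcases lt_or_ge |α - q| (1 / (2 * (q.den : ℝ) ^ 2)) with hlt | hge
    · obtain ⟨l, hl⟩ := Real.exists_convs_eq_rat hlt
      have hden := den_eq_of_convs_eq hα hl
      rw [← hl]
      refine le_trans ?_ (abs_sub_convs_ge hα l)
      have h3 := hle l
      rw [convergentDenom, hden] at h3
      rw [hden]
      have h4 : 1 ≤ (q.den : ℝ) ^ (1 / 2 : ℝ) := Real.one_le_rpow hd1 (by norm_num)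
      have h5 : (q.den : ℝ) ^ (5 / 2 : ℝ) = (q.den : ℝ) ^ 2 * (q.den : ℝ) ^ (1 / 2 : ℝ) := by
        rw [← Real.rpow_natCast, ← Real.rpow_add hd0]
        norm_num
      have h6 := one_le_partialQuotient hα l
      refine one_div_le_one_div_of_le (by positivity) ?_
      rw [h5]
      have : partialQuotient α (l + 1) + 2 ≤ (C + 2) * (q.den : ℝ) ^ (1 / 2 : ℝ) := by nlinarith
      nlinarith [mul_le_mul_of_nonneg_left this (sq_nonneg (q.den : ℝ))]
    · refine le_trans ?_ hge
      have h5 : (q.den : ℝ) ^ 2 ≤ (q.den : ℝ) ^ (5 / 2 : ℝ) := by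
        rw [← Real.rpow_natCast]
        exact Real.rpow_le_rpow_of_exponent_le hd1 (by norm_num)
      refine one_div_le_one_div_of_le (by positivity) ?_
      have : 0 < (q.den : ℝ) ^ 2 := by positivity
      nlinarith
  rw [h2]
  calc 1 / (C + 2) / (m : ℝ) ^ (3 / 2 : ℝ) = m * (1 / ((C + 2) * (m : ℝ) ^ (5 / 2 : ℝ))) := by
        rw [rpow_five_halves hpos]
        field_simp
    _ ≤ m * (1 / ((C + 2) * (q.den : ℝ) ^ (5 / 2 : ℝ))) := by gcongr
    _ ≤ _ := by gcongr

/-! ### Cosine sums and the convergence of `∑ 1/(m²‖mα‖)` -/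

theorem abs_sin_pi_mul_ge (x : ℝ) : 2 * |x - round x| ≤ |Real.sin (Real.pi * x)| := by
  have h1 : |Real.sin (Real.pi * x)| = Real.sin (Real.pi * |x - round x|) := by
    have h2 : |Real.sin (Real.pi * x)| = |Real.sin (Real.pi * (x - round x))| := by
      rw [show Real.pi * (x - round x) = Real.pi * x - round x * Real.pi by ring,
        Real.sin_sub_int_mul_pi, abs_mul, abs_zpow]
      simp
    have hr := abs_sub_round x
    have hpi := Real.pi_pos
    rw [h2, ← abs_of_pos hpi, ← abs_mul, abs_of_pos hpi, Real.abs_sin_eq_sin_abs_of_abs_le_pi]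
    rw [abs_mul, abs_of_pos hpi]
    nlinarith
  have hr := abs_sub_round x
  have hpi := Real.pi_pos
  rw [h1]
  have := Real.mul_le_sin (x := Real.pi * |x - round x|) (by positivity) (by nlinarith)
  calc 2 * |x - round x| = 2 / Real.pi * (Real.pi * |x - round x|) := by field_simp
    _ ≤ _ := this

/-- Multiplying by `2 sin(θ/2)` makes the sum telescope to a difference of two sines. -/
theorem abs_sum_cos_le (a θ : ℝ) (N : ℕ) :
    |Real.sin (θ / 2)| * |∑ k ∈ Finset.range N, Real.cos (a + k * θ)| ≤ 1 := by
  have key : 2 * Real.sin (θ / 2) * ∑ k ∈ Finset.range N, Real.cos (a + k * θ) =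
      Real.sin (a + (N - 1 / 2) * θ) - Real.sin (a - θ / 2) := by
    induction N with
    | zero =>
      simp only [Finset.range_zero, Finset.sum_empty, mul_zero, Nat.cast_zero]
      rw [show a + (0 - 1 / 2) * θ = a - θ / 2 by ring, sub_self]
    | succ N ih =>
      rw [Finset.sum_range_succ, mul_add, ih]
      push_cast
      rw [show a + ((N : ℝ) + 1 - 1 / 2) * θ = (a + N * θ) + θ / 2 by ring,
        show a + ((N : ℝ) - 1 / 2) * θ = (a + N * θ) - θ / 2 by ring,
        Real.sin_add (a + N * θ), Real.sin_sub (a + N * θ)]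
      ring
  rw [← abs_mul]
  have h1 := abs_sub (Real.sin (a + (N - 1 / 2) * θ)) (Real.sin (a - θ / 2))
  have h2 := Real.abs_sin_le_one (a + (N - 1 / 2) * θ)
  have h3 := Real.abs_sin_le_one (a - θ / 2)
  rw [← key, mul_assoc, abs_mul, abs_two] at h1
  linarith

/-- Separation puts at most one point in each cell of length `δ`, so the sum is compared with one
over the nonzero integers that label the cells. -/
theorem sum_inv_abs_le_of_separated {ι : Type*} (s : Finset ι) (p : ι → ℝ) {δ : ℝ} (hδ : 0 < δ)
    (hp : ∀ i ∈ s, δ ≤ |p i|) (hp1 : ∀ i ∈ s, |p i| ≤ 1)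
    (hsep : ∀ i ∈ s, ∀ j ∈ s, i ≠ j → δ ≤ |p i - p j|) :
    ∑ i ∈ s, |p i|⁻¹ ≤ (2 / δ) ^ (5 / 4 : ℝ) * ∑' j : ℤ, |(j : ℝ)| ^ (-(5 / 4) : ℝ) := by
  classical
  have hinj : Set.InjOn (fun i => ⌊p i / δ⌋) s := by
    intro i hi j hj hij
    by_contra hne
    have h1 := Int.abs_sub_lt_one_of_floor_eq_floor hij
    rw [← sub_div, abs_div, abs_of_pos hδ, div_lt_one hδ] at h1
    exact absurd (hsep i hi j hj hne) (not_le.2 h1)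
  have hterm : ∀ i ∈ s, |p i|⁻¹ ≤
      (2 / δ) ^ (5 / 4 : ℝ) * |(⌊p i / δ⌋ : ℝ)| ^ (-(5 / 4) : ℝ) := by
    intro i hi
    have hpi : 0 < |p i| := hδ.trans_le (hp i hi)
    have hx : 1 ≤ |p i / δ| := by
      rw [abs_div, abs_of_pos hδ, one_le_div hδ]
      exact hp i hi
    have hfl := Int.floor_le (p i / δ)
    have hfl2 := Int.lt_floor_add_one (p i / δ)
    have hj0 : (0 : ℝ) < |(⌊p i / δ⌋ : ℝ)| := by
      rw [abs_pos]
      intro h0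
      rw [h0] at hfl hfl2
      rw [abs_of_nonneg hfl] at hx
      linarith
    have hj : |(⌊p i / δ⌋ : ℝ)| ≤ 2 * |p i / δ| := by
      rcases abs_cases (p i / δ) with h | h <;> rcases abs_cases (⌊p i / δ⌋ : ℝ) with h' | h' <;>
        linarith
    have hpj : δ * |(⌊p i / δ⌋ : ℝ)| / 2 ≤ |p i| := by
      rw [abs_div, abs_of_pos hδ] at hj
      have : δ * |(⌊p i / δ⌋ : ℝ)| ≤ δ * (2 * (|p i| / δ)) := by gcongr
      have h3 : δ * (2 * (|p i| / δ)) = 2 * |p i| := by field_simp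
      linarith
    -- As `|p i| ≤ 1`, the exponent may be raised beyond `1`, which replaces a logarithmic harmonic
    -- sum by a convergent series.
    calc |p i|⁻¹ = |p i| ^ (-1 : ℝ) := (Real.rpow_neg_one _).symm
      _ ≤ |p i| ^ (-(5 / 4) : ℝ) :=
        Real.rpow_le_rpow_of_exponent_ge hpi (hp1 i hi) (by norm_num)
      _ ≤ (δ * |(⌊p i / δ⌋ : ℝ)| / 2) ^ (-(5 / 4) : ℝ) :=
        Real.rpow_le_rpow_of_nonpos (by positivity) hpj (by norm_num)
      _ = _ := by
        rw [show δ * |(⌊p i / δ⌋ : ℝ)| / 2 = (2 / δ)⁻¹ * |(⌊p i / δ⌋ : ℝ)| by field_simp,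
          Real.mul_rpow (by positivity) hj0.le, Real.inv_rpow (by positivity),
          Real.rpow_neg (by positivity), inv_inv]
  have hsummable : Summable (fun j : ℤ => |(j : ℝ)| ^ (-(5 / 4) : ℝ)) :=
    Real.summable_abs_int_rpow (by norm_num)
  calc ∑ i ∈ s, |p i|⁻¹ ≤ ∑ i ∈ s, (2 / δ) ^ (5 / 4 : ℝ) *
        |(⌊p i / δ⌋ : ℝ)| ^ (-(5 / 4) : ℝ) := Finset.sum_le_sum hterm
    _ = (2 / δ) ^ (5 / 4 : ℝ) * ∑ j ∈ s.image (fun i => ⌊p i / δ⌋),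
        |(j : ℝ)| ^ (-(5 / 4) : ℝ) := by
      rw [← Finset.mul_sum, Finset.sum_image hinj]
    _ ≤ _ := by
      gcongr
      exact hsummable.sum_le_tsum _ (fun j _ => by positivity)

theorem summable_of_dyadic {f : ℕ → ℝ} (hf : ∀ n, 0 ≤ f n) (h0 : f 0 = 0) {K r : ℝ}
    (hK : 0 ≤ K) (hr0 : 0 ≤ r) (hr : r < 1)
    (h : ∀ k : ℕ, ∑ m ∈ Finset.Ico (2 ^ k) (2 ^ (k + 1)), f m ≤ K * r ^ k) : Summable f := by
  have hgeom := summable_geometric_of_lt_one hr0 hr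
  have hdy : ∀ n : ℕ, ∑ m ∈ Finset.range (2 ^ n), f m ≤ ∑ k ∈ Finset.range n, K * r ^ k := by
    intro n
    induction n with
    | zero => simp [h0]
    | succ n ih =>
      rw [Finset.sum_range_succ, ← Finset.sum_range_add_sum_Ico f
        (Nat.pow_le_pow_right two_pos n.le_succ)]
      exact add_le_add ih (h n)
  refine summable_of_sum_range_le (c := K * ∑' k, r ^ k) hf fun n => ?_
  calc ∑ m ∈ Finset.range n, f m ≤ ∑ m ∈ Finset.range (2 ^ n), f m :=
        Finset.sum_le_sum_of_subset_of_nonneg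
          (Finset.range_mono (Nat.lt_two_pow_self.le)) (fun m _ _ => hf m)
    _ ≤ ∑ k ∈ Finset.range n, K * r ^ k := hdy n
    _ = K * ∑ k ∈ Finset.range n, r ^ k := by rw [Finset.mul_sum]
    _ ≤ _ := by
      gcongr
      exact hgeom.sum_le_tsum _ (fun k _ => by positivity)

theorem IsDiophantine.sum_block_le {α c : ℝ} (hc : 0 < c)
    (h : ∀ m : ℕ, 1 ≤ m → ∀ n : ℤ, c / (m : ℝ) ^ (3 / 2 : ℝ) ≤ |m * α - n|) (k : ℕ) :
    ∑ m ∈ Finset.Ico (2 ^ k : ℕ) (2 ^ (k + 1)), |(m : ℝ) * α - round (m * α)|⁻¹ ≤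
      (2 / (c / ((2 : ℝ) ^ (k + 1)) ^ (3 / 2 : ℝ))) ^ (5 / 4 : ℝ) *
        ∑' j : ℤ, |(j : ℝ)| ^ (-(5 / 4) : ℝ) := by
  have hmono : ∀ m : ℕ, 1 ≤ m → m ≤ 2 ^ (k + 1) → ∀ n : ℤ,
      c / ((2 : ℝ) ^ (k + 1)) ^ (3 / 2 : ℝ) ≤ |m * α - n| := by
    intro m h1 h2 n
    refine le_trans ?_ (h m h1 n)
    have h3 : (0 : ℝ) < m := by exact_mod_cast h1
    have h4 : (m : ℝ) ≤ 2 ^ (k + 1) := by exact_mod_cast h2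
    gcongr
  -- The difference of two signed distances is `(j - i)α` minus an integer, so the Diophantine bound
  -- for `j - i` separates them.
  have hsep : ∀ i j : ℕ, i < j → j ≤ 2 ^ (k + 1) →
      c / ((2 : ℝ) ^ (k + 1)) ^ (3 / 2 : ℝ) ≤
        |((j : ℝ) * α - round (j * α)) - ((i : ℝ) * α - round (i * α))| := by
    intro i j hij hj
    have := hmono (j - i) (by omega) (by omega) (round (j * α) - round (i * α))
    push_cast [Nat.cast_sub hij.le] at this
    refine this.trans (le_of_eq ?_)
    congr 1
    ring
  refine sum_inv_abs_le_of_separated _ _ (by positivity) ?_ ?_ ?_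
  · intro m hm
    have hm' := Finset.mem_Ico.1 hm
    exact hmono m (Nat.one_le_two_pow.trans hm'.1) hm'.2.le _
  · intro m _
    linarith [abs_sub_round ((m : ℝ) * α)]
  · intro i hi j hj hij
    have hi' := Finset.mem_Ico.1 hi
    have hj' := Finset.mem_Ico.1 hj
    rcases lt_or_gt_of_ne hij with hlt | hlt
    · rw [abs_sub_comm]
      exact hsep i j hlt hj'.2.le
    · exact hsep j i hlt hi'.2.le

theorem IsDiophantine.summable {α : ℝ} (hα : IsDiophantine α) :
    Summable (fun m : ℕ => 1 / (m : ℝ) ^ 2 * |(m : ℝ) * α - round (m * α)|⁻¹) := by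
  obtain ⟨c, hc, h⟩ := hα
  set Z : ℝ := ∑' j : ℤ, |(j : ℝ)| ^ (-(5 / 4) : ℝ) with hZ
  have hZ0 : 0 ≤ Z := tsum_nonneg fun j => by positivity
  -- Block `k` contributes about `2^{-2k} (2^{3k/2})^{5/4} = 2^{-k/8}`; the exponent `5/4` works
  -- because it lies between `1` and `4/3`.
  refine summable_of_dyadic (K := (2 / c) ^ (5 / 4 : ℝ) * (2 : ℝ) ^ (15 / 8 : ℝ) * Z)
    (r := (2 : ℝ) ^ (-(1 / 8) : ℝ)) (fun n => by positivity) (by simp) (by positivity)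
    (by positivity) (Real.rpow_lt_one_of_one_lt_of_neg (by norm_num) (by norm_num)) fun k => ?_
  have h1 : ∑ m ∈ Finset.Ico (2 ^ k : ℕ) (2 ^ (k + 1)),
      1 / (m : ℝ) ^ 2 * |(m : ℝ) * α - round (m * α)|⁻¹ ≤
      1 / ((2 : ℝ) ^ k) ^ 2 * ∑ m ∈ Finset.Ico (2 ^ k : ℕ) (2 ^ (k + 1)),
        |(m : ℝ) * α - round (m * α)|⁻¹ := by
    rw [Finset.mul_sum]
    refine Finset.sum_le_sum fun m hm => ?_
    have : (2 : ℝ) ^ k ≤ m := by exact_mod_cast (Finset.mem_Ico.1 hm).1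
    gcongr
  refine h1.trans ?_
  have h2 := IsDiophantine.sum_block_le hc h k
  rw [← hZ] at h2
  have h3 : (2 / (c / ((2 : ℝ) ^ (k + 1)) ^ (3 / 2 : ℝ))) ^ (5 / 4 : ℝ) =
      (2 / c) ^ (5 / 4 : ℝ) * (2 : ℝ) ^ (15 / 8 : ℝ) * (2 : ℝ) ^ (15 / 8 * k : ℝ) := by
    rw [div_div_eq_mul_div, mul_div_right_comm, Real.mul_rpow (by positivity) (by positivity),
      ← Real.rpow_mul (by positivity), ← Real.rpow_natCast, ← Real.rpow_mul (by norm_num),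
      mul_assoc, ← Real.rpow_add (by norm_num)]
    push_cast
    ring_nf
  have h4 : 1 / ((2 : ℝ) ^ k) ^ 2 * (2 : ℝ) ^ (15 / 8 * k : ℝ) =
      ((2 : ℝ) ^ (-(1 / 8) : ℝ)) ^ k := by
    rw [← Real.rpow_natCast (_ ^ (-(1 / 8) : ℝ)), ← Real.rpow_mul (by norm_num), one_div,
      ← pow_mul, ← Real.rpow_natCast, ← Real.rpow_neg (by norm_num),
      ← Real.rpow_add (by norm_num)]
    push_cast
    ring_nf
  calc _ ≤ 1 / ((2 : ℝ) ^ k) ^ 2 *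
        ((2 / (c / ((2 : ℝ) ^ (k + 1)) ^ (3 / 2 : ℝ))) ^ (5 / 4 : ℝ) * Z) := by gcongr
    _ = _ := by
      rw [h3, ← h4]
      ring

/-! ### Birkhoff sums of the periodic parabola -/

/-- The `1`-periodic function `{y}(1 - {y})`. -/
def fractParabola (y : ℝ) : ℝ := Int.fract y * (1 - Int.fract y)

/-- The left-hand function is `-B₂({y})` for the Bernoulli polynomial `B₂(x) = x² - x + 1/6`. -/
theorem hasSum_fractParabola (y : ℝ) :
    HasSum (fun n : ℕ => -(1 / Real.pi ^ 2) * (1 / (n : ℝ) ^ 2 * Real.cos (2 * Real.pi * n * y)))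
      (fractParabola y - 1 / 6) := by
  have h := hasSum_one_div_nat_pow_mul_cos one_ne_zero
    (x := Int.fract y) ⟨Int.fract_nonneg y, (Int.fract_lt_one y).le⟩
  have hcos : ∀ n : ℕ, Real.cos (2 * Real.pi * n * Int.fract y) =
      Real.cos (2 * Real.pi * n * y) := by
    intro n
    rw [show 2 * Real.pi * n * y =
      2 * Real.pi * n * Int.fract y + (n * ⌊y⌋ : ℤ) * (2 * Real.pi) by
        conv_lhs => rw [← Int.fract_add_floor y]
        push_cast
        ring, Real.cos_add_int_mul_two_pi]
  simp only [hcos] at h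
  convert! h.mul_left (-(1 / Real.pi ^ 2)) using 1
  have hb : (Polynomial.map (algebraMap ℚ ℝ) (Polynomial.bernoulli (2 * 1))).eval (Int.fract y) =
      Int.fract y ^ 2 - Int.fract y + 1 / 6 := by
    simp [Polynomial.bernoulli, Finset.sum_range_succ, bernoulli_two, bernoulli_one,
      Polynomial.eval_monomial]
    ring
  rw [hb, fractParabola]
  have := Real.pi_pos.ne'
  simp [Nat.factorial]
  field_simp
  ring

theorem IsDiophantine.exists_sum_fractParabola_le {α : ℝ} (hα : IsDiophantine α) :
    ∃ C : ℝ, ∀ (y : ℝ) (N : ℕ),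
      |∑ k ∈ Finset.range N, (fractParabola (y + k * α) - 1 / 6)| ≤ C := by
  obtain ⟨c, hc, hlow⟩ := id hα
  refine ⟨∑' m : ℕ, 1 / (m : ℝ) ^ 2 * |(m : ℝ) * α - round (m * α)|⁻¹, fun y N => ?_⟩
  have h := hasSum_sum (s := Finset.range N) (fun k _ => hasSum_fractParabola (y + k * α))
  refine h.norm_le_of_bounded hα.summable.hasSum fun n => ?_
  rw [← Finset.mul_sum, ← Finset.mul_sum, Real.norm_eq_abs, abs_mul, abs_mul, abs_neg]
  rcases Nat.eq_zero_or_pos n with rfl | hn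
  · simp
  have hd : 0 < |(n : ℝ) * α - round (n * α)| := lt_of_lt_of_le (by positivity) (hlow n hn _)
  have hcos : |∑ k ∈ Finset.range N, Real.cos (2 * Real.pi * n * (y + k * α))| ≤
      |(n : ℝ) * α - round (n * α)|⁻¹ := by
    have h1 := abs_sum_cos_le (2 * Real.pi * n * y) (2 * Real.pi * n * α) N
    have h2 := abs_sin_pi_mul_ge (n * α)
    rw [show 2 * Real.pi * n * α / 2 = Real.pi * (n * α) by ring] at h1
    have h3 : ∑ k ∈ Finset.range N, Real.cos (2 * Real.pi * n * (y + k * α)) =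
        ∑ k ∈ Finset.range N, Real.cos (2 * Real.pi * n * y + k * (2 * Real.pi * n * α)) :=
      Finset.sum_congr rfl fun k _ => by ring_nf
    rw [h3, ← one_div, le_div_iff₀ hd, mul_comm]
    refine le_trans ?_ h1
    exact mul_le_mul_of_nonneg_right (by linarith) (abs_nonneg _)
  have hpi : |1 / Real.pi ^ 2| ≤ 1 := by
    rw [abs_of_nonneg (by positivity), div_le_one (by positivity)]
    nlinarith [Real.pi_gt_three]
  rw [abs_of_nonneg (by positivity : (0 : ℝ) ≤ 1 / (n : ℝ) ^ 2)]
  calc _ ≤ 1 * (1 / (n : ℝ) ^ 2 * |(n : ℝ) * α - round (n * α)|⁻¹) := by gcongr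
    _ = _ := one_mul _

/-! ### Piecewise quadratic functions and the removal of corners -/

/-- Near `z` the function `F` is a quadratic polynomial with leading coefficient `κ`. -/
def IsLocallyQuadraticAt (κ : ℝ) (F : ℝ → ℝ) (z : ℝ) : Prop :=
  ∃ a b : ℝ, ∀ᶠ y in 𝓝 z, F y = κ * y ^ 2 + a * y + b

/-- Since `κ` is common to all points, `F - κ y²` is locally affine; its derivative is locally
constant, hence constant on a connected open set. -/
theorem exists_eq_quadratic_of_isLocallyQuadraticAt {κ : ℝ} {F : ℝ → ℝ} {s : Set ℝ}
    (hs : IsOpen s) (hs' : IsPreconnected s) (h : ∀ z ∈ s, IsLocallyQuadraticAt κ F z) :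
    ∃ a b : ℝ, ∀ y ∈ s, F y = κ * y ^ 2 + a * y + b := by
  set G : ℝ → ℝ := fun y => F y - κ * y ^ 2 with hG
  have hloc : ∀ z ∈ s, ∃ a b : ℝ, G =ᶠ[𝓝 z] fun y => a * y + b := by
    intro z hz
    obtain ⟨a, b, hab⟩ := h z hz
    refine ⟨a, b, hab.mono fun y hy => ?_⟩
    simp only [hG, hy]
    ring
  have hderiv : ∀ z ∈ s, ∃ a : ℝ, deriv G =ᶠ[𝓝 z] fun _ => a := by
    intro z hz
    obtain ⟨a, b, hab⟩ := hloc z hz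
    refine ⟨a, hab.deriv.trans (Eventually.of_forall fun y => ?_)⟩
    simp [deriv_add_const]
  obtain ⟨a, ha⟩ := hs.exists_is_const_of_deriv_eq_zero hs' (f := deriv G)
    (fun z hz => by
      obtain ⟨a, ha⟩ := hderiv z hz
      exact (ha.differentiableAt_iff.2 (differentiableAt_const a)).differentiableWithinAt)
    (fun z hz => by
      obtain ⟨a, ha⟩ := hderiv z hz
      simp [ha.deriv_eq])
  have hdiff : ∀ z ∈ s, DifferentiableAt ℝ G z := by
    intro z hz
    obtain ⟨a, b, hab⟩ := hloc z hz
    exact hab.differentiableAt_iff.2 (by fun_prop)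
  obtain ⟨b, hb⟩ := hs.exists_is_const_of_deriv_eq_zero hs' (f := fun y => G y - a * y)
    (fun z hz => ((hdiff z hz).sub (by fun_prop)).differentiableWithinAt)
    (fun z hz => by
      have h1 : HasDerivAt (fun y => G y - a * y) (deriv G z - a) z := by
        have h2 := (hdiff z hz).hasDerivAt.fun_sub ((hasDerivAt_id z).const_mul a)
        simpa only [id, mul_one] using h2
      simp [h1.deriv, ha z hz])
  refine ⟨a, b, fun y hy => ?_⟩
  have := hb y hy
  simp only [hG] at this
  linarith

theorem IsLocallyQuadraticAt.add_int {κ : ℝ} {F : ℝ → ℝ} {z : ℝ} (hF : Function.Periodic F 1)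
    (h : IsLocallyQuadraticAt κ F z) (n : ℤ) : IsLocallyQuadraticAt κ F (z + n) := by
  obtain ⟨a, b, hab⟩ := h
  refine ⟨a - 2 * κ * n, b + κ * n ^ 2 - a * n, ?_⟩
  have ht : Tendsto (fun y : ℝ => y - n) (𝓝 (z + n)) (𝓝 z) := by
    have : Tendsto (fun y : ℝ => y - n) (𝓝 (z + n)) (𝓝 (z + n - n)) :=
      (continuous_id.sub continuous_const).tendsto _
    simpa using this
  filter_upwards [ht.eventually hab] with y hy
  have hp : F (y - n) = F y := by simpa using hF.sub_int_mul_eq n (x := y)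
  rw [← hp, hy]
  ring

theorem IsLocallyQuadraticAt.add {κ κ' : ℝ} {F G : ℝ → ℝ} {z : ℝ}
    (hF : IsLocallyQuadraticAt κ F z) (hG : IsLocallyQuadraticAt κ' G z) :
    IsLocallyQuadraticAt (κ + κ') (fun y => F y + G y) z := by
  obtain ⟨a, b, h⟩ := hF
  obtain ⟨a', b', h'⟩ := hG
  refine ⟨a + a', b + b', ?_⟩
  filter_upwards [h, h'] with y hy hy'
  rw [hy, hy']
  ring

theorem IsLocallyQuadraticAt.const_mul {κ : ℝ} {F : ℝ → ℝ} {z : ℝ}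
    (hF : IsLocallyQuadraticAt κ F z) (w : ℝ) :
    IsLocallyQuadraticAt (w * κ) (fun y => w * F y) z := by
  obtain ⟨a, b, h⟩ := hF
  refine ⟨w * a, w * b, ?_⟩
  filter_upwards [h] with y hy
  rw [hy]
  ring

theorem continuous_fractParabola : Continuous fractParabola :=
  ContinuousOn.comp_fract'' (f := fun x : ℝ => x * (1 - x)) (by fun_prop) (by norm_num)

theorem fractParabola_periodic : Function.Periodic fractParabola 1 := fun y => by
  simp [fractParabola]

theorem isLocallyQuadraticAt_fractParabola_sub {d z : ℝ} (h : ∀ n : ℤ, z ≠ d + n) :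
    IsLocallyQuadraticAt (-1) (fun y => fractParabola (y - d)) z := by
  set m := ⌊z - d⌋ with hm
  have h1 : (m : ℝ) < z - d := by
    refine lt_of_le_of_ne (Int.floor_le _) fun he => h m ?_
    linarith
  have h2 : z - d < m + 1 := Int.lt_floor_add_one _
  refine ⟨2 * (d + m) + 1, -(d + m) ^ 2 - (d + m), ?_⟩
  have hnhds : Ioo (d + m) (d + m + 1) ∈ 𝓝 z := Ioo_mem_nhds (by linarith) (by linarith)
  filter_upwards [hnhds] with y hy
  have hfl : ⌊y - d⌋ = m := by
    rw [Int.floor_eq_iff]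
    constructor <;> linarith [hy.1, hy.2]
  simp only [fractParabola, Int.fract, hfl]
  ring

theorem fractParabola_sub_eq {d y : ℝ} (h : |y - d| < 1) :
    fractParabola (y - d) = |y - d| - (y - d) ^ 2 := by
  rw [abs_lt] at h
  rcases le_or_gt 0 (y - d) with h0 | h0
  · have hfl : ⌊y - d⌋ = 0 := by
      rw [Int.floor_eq_iff]
      constructor <;> push_cast <;> linarith
    simp only [fractParabola, Int.fract, hfl, abs_of_nonneg h0]
    push_cast
    ring
  · have hfl : ⌊y - d⌋ = -1 := by
      rw [Int.floor_eq_iff]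
      constructor <;> push_cast <;> linarith
    simp only [fractParabola, Int.fract, hfl, abs_of_neg h0]
    push_cast
    ring

theorem eventually_nhdsNE_ne_add_int (d e : ℝ) : ∀ᶠ z in 𝓝[≠] d, ∀ n : ℤ, z ≠ e + n := by
  by_cases h : ∃ m : ℤ, d = e + m
  · obtain ⟨m, rfl⟩ := h
    have : ∀ᶠ z in 𝓝[≠] (e + m : ℝ), z ∈ Metric.ball (e + m : ℝ) 1 :=
      nhdsWithin_le_nhds (Metric.ball_mem_nhds _ one_pos)
    filter_upwards [this, self_mem_nhdsWithin] with z hz hne n hn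
    apply hne
    rw [Metric.mem_ball, Real.dist_eq, hn] at hz
    have h1 : |((n - m : ℤ) : ℝ)| < 1 := by
      push_cast
      convert hz using 2
      ring
    have h2 : n - m = 0 := Int.abs_lt_one_iff.1 (by exact_mod_cast h1)
    rw [hn, show n = m by omega]
    rfl
  · have hcl : IsClosed (range fun n : ℤ => e + (n : ℝ)) :=
      ((Homeomorph.addLeft e).isClosedEmbedding.comp
        Int.isClosedEmbedding_coe_real).isClosed_range
    have : ∀ᶠ z in 𝓝 d, z ∉ range fun n : ℤ => e + (n : ℝ) :=
      hcl.isOpen_compl.mem_nhds fun ⟨n, hn⟩ => h ⟨n, hn.symm⟩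
    filter_upwards [nhdsWithin_le_nhds this] with z hz n hn
    exact hz ⟨n, hn.symm⟩

/-- A corner of `F` at `d` is removed by subtracting a multiple of the translated parabola. -/
theorem exists_isLocallyQuadraticAt_sub_fractParabola {κ : ℝ} {F : ℝ → ℝ} (hF : Continuous F)
    {d : ℝ} (h : ∀ᶠ z in 𝓝[≠] d, IsLocallyQuadraticAt κ F z) :
    ∃ w : ℝ, IsLocallyQuadraticAt (κ + w) (fun y => F y + -w * fractParabola (y - d)) d := by
  obtain ⟨ε, hε, hball⟩ := Metric.mem_nhdsWithin_iff.1 h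
  have hmem : ∀ z, |z - d| < ε → z ≠ d → IsLocallyQuadraticAt κ F z := fun z hz hne =>
    hball ⟨by rwa [Metric.mem_ball, Real.dist_eq], hne⟩
  obtain ⟨a, b, hab⟩ := exists_eq_quadratic_of_isLocallyQuadraticAt (κ := κ) (F := F)
    (isOpen_Ioo (a := d - ε) (b := d)) isPreconnected_Ioo
    (fun z hz => hmem z (by rw [abs_lt]; constructor <;> linarith [hz.1, hz.2]) hz.2.ne)
  obtain ⟨a', b', hab'⟩ := exists_eq_quadratic_of_isLocallyQuadraticAt (κ := κ) (F := F)
    (isOpen_Ioo (a := d) (b := d + ε)) isPreconnected_Ioo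
    (fun z hz => hmem z (by rw [abs_lt]; constructor <;> linarith [hz.1, hz.2]) hz.1.ne')
  -- Continuity makes both one-sided quadratics take the value `F d` at `d`, so only a jump of the
  -- slope is left.
  have hd : F d = κ * d ^ 2 + a * d + b := by
    have h1 : Tendsto F (𝓝[<] d) (𝓝 (F d)) := hF.continuousAt.continuousWithinAt
    have hc : Continuous fun y : ℝ => κ * y ^ 2 + a * y + b := by fun_prop
    have h2 : Tendsto (fun y : ℝ => κ * y ^ 2 + a * y + b) (𝓝[<] d) (𝓝 _) :=
      hc.continuousAt.continuousWithinAt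
    refine tendsto_nhds_unique (h1.congr' ?_) h2
    filter_upwards [Ioo_mem_nhdsLT (show d - ε < d by linarith)] with y hy using hab y hy
  have hd' : F d = κ * d ^ 2 + a' * d + b' := by
    have h1 : Tendsto F (𝓝[>] d) (𝓝 (F d)) := hF.continuousAt.continuousWithinAt
    have hc : Continuous fun y : ℝ => κ * y ^ 2 + a' * y + b' := by fun_prop
    have h2 : Tendsto (fun y : ℝ => κ * y ^ 2 + a' * y + b') (𝓝[>] d) (𝓝 _) :=
      hc.continuousAt.continuousWithinAt
    refine tendsto_nhds_unique (h1.congr' ?_) h2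
    filter_upwards [Ioo_mem_nhdsGT (show d < d + ε by linarith)] with y hy using hab' y hy
  -- Near `d` the translated parabola is `|y - d| - (y - d)²`, with slope jump `2`.
  set w := (a' - a) / 2 with hw
  refine ⟨w, (a + w) - 2 * w * d, F d - κ * d ^ 2 + w * d ^ 2 - (a + w) * d, ?_⟩
  have hnhds : Metric.ball d (min ε 1) ∈ 𝓝 d := Metric.ball_mem_nhds _ (lt_min hε one_pos)
  filter_upwards [hnhds] with y hy
  rw [Metric.mem_ball, Real.dist_eq, lt_min_iff] at hy
  rw [fractParabola_sub_eq hy.2]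
  have hy1 := abs_lt.1 hy.1
  rcases lt_trichotomy y d with hlt | rfl | hlt
  · rw [hab y ⟨by linarith, hlt⟩, abs_of_neg (by linarith)]
    linear_combination -hd
  · simp
    ring
  · rw [hab' y ⟨hlt, by linarith⟩, abs_of_pos (by linarith)]
    linear_combination -hd' + 2 * (y - d) * hw

/-! ### Bounded discrepancy of periodic functions with corners -/

/-- The Birkhoff sums of `F` along the rotation by `α` stay within bounded distance from `N μ`. -/
def HasBoundedDiscrepancy (α : ℝ) (F : ℝ → ℝ) (μ : ℝ) : Prop :=
  ∃ C : ℝ, ∀ (y : ℝ) (N : ℕ), |∑ k ∈ Finset.range N, (F (y + k * α) - μ)| ≤ C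

theorem HasBoundedDiscrepancy.add_const_mul {α : ℝ} {F G : ℝ → ℝ} {μ ν : ℝ}
    (hF : HasBoundedDiscrepancy α F μ) (hG : HasBoundedDiscrepancy α G ν) (w : ℝ) :
    HasBoundedDiscrepancy α (fun y => F y + w * G y) (μ + w * ν) := by
  obtain ⟨C, hC⟩ := hF
  obtain ⟨C', hC'⟩ := hG
  refine ⟨C + |w| * C', fun y N => ?_⟩
  have : ∑ k ∈ Finset.range N, (F (y + k * α) + w * G (y + k * α) - (μ + w * ν)) =
      ∑ k ∈ Finset.range N, (F (y + k * α) - μ) +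
        w * ∑ k ∈ Finset.range N, (G (y + k * α) - ν) := by
    rw [Finset.mul_sum, ← Finset.sum_add_distrib]
    exact Finset.sum_congr rfl fun k _ => by ring
  rw [this]
  refine (abs_add_le _ _).trans (add_le_add (hC y N) ?_)
  rw [abs_mul]
  exact mul_le_mul_of_nonneg_left (hC' y N) (abs_nonneg w)

theorem HasBoundedDiscrepancy.comp_sub {α : ℝ} {F : ℝ → ℝ} {μ : ℝ}
    (hF : HasBoundedDiscrepancy α F μ) (d : ℝ) :
    HasBoundedDiscrepancy α (fun y => F (y - d)) μ := by
  obtain ⟨C, hC⟩ := hF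
  refine ⟨C, fun y N => ?_⟩
  convert hC (y - d) N using 6
  ring

/-- Induction on the set of corners modulo `1`. Removing a corner changes the leading coefficient,
so `κ` has to be arbitrary even though the application starts from `κ = 0`. -/
theorem exists_hasBoundedDiscrepancy {α : ℝ} (hα : IsDiophantine α) (D : Finset ℝ) :
    ∀ (κ : ℝ) (F : ℝ → ℝ), Continuous F → Function.Periodic F 1 →
      (∀ z, (∀ d ∈ D, ∀ n : ℤ, z ≠ d + n) → IsLocallyQuadraticAt κ F z) →
      ∃ μ, HasBoundedDiscrepancy α F μ := by
  classical
  induction D using Finset.induction_on with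
  | empty =>
    intro κ F _ hper hloc
    obtain ⟨a, b, hab⟩ := exists_eq_quadratic_of_isLocallyQuadraticAt (κ := κ) (F := F)
      isOpen_univ isPreconnected_univ (fun z _ => hloc z (by simp))
    -- Equal values at `0`, `1`, `2` force a global quadratic to be constant.
    have h1 := hper 0
    have h2 := hper 1
    rw [hab _ (mem_univ _), hab _ (mem_univ _)] at h1 h2
    refine ⟨b, 0, fun y N => ?_⟩
    have hκ : κ = 0 := by linarith
    have ha : a = 0 := by linarith
    have hF : ∀ y, F y = b := fun y => by
      rw [hab y (mem_univ _), hκ, ha]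
      ring
    simp [hF]
  | insert d D hd ih =>
    intro κ F hcont hper hloc
    have hev : ∀ᶠ z in 𝓝[≠] d, IsLocallyQuadraticAt κ F z := by
      have : ∀ᶠ z in 𝓝[≠] d, ∀ e ∈ insert d D, ∀ n : ℤ, z ≠ e + n :=
        (Finset.eventually_all _).2 fun e _ => eventually_nhdsNE_ne_add_int d e
      exact this.mono hloc
    obtain ⟨w, hw⟩ := exists_isLocallyQuadraticAt_sub_fractParabola hcont hev
    have hper' : Function.Periodic (fun y => F y + -w * fractParabola (y - d)) 1 := fun y => by
      simp only [hper y, add_sub_right_comm, fractParabola_periodic (y - d)]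
    obtain ⟨μ, hμ⟩ := ih (κ + w) (fun y => F y + -w * fractParabola (y - d))
      (hcont.add (continuous_const.mul (continuous_fractParabola.comp
        (continuous_id.sub continuous_const)))) hper' (fun z hz => by
        by_cases hzd : ∃ n : ℤ, z = d + n
        · obtain ⟨n, rfl⟩ := hzd
          exact hw.add_int hper' n
        · push Not at hzd
          have h1 := (hloc z (by
            intro e he
            rcases Finset.mem_insert.1 he with rfl | he
            · exact hzd
            · exact hz e he)).add
            ((isLocallyQuadraticAt_fractParabola_sub hzd).const_mul (-w))
          convert h1 using 1
          ring)
    have hφ : HasBoundedDiscrepancy α (fun y => fractParabola (y - d)) (1 / 6) :=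
      HasBoundedDiscrepancy.comp_sub (F := fractParabola) hα.exists_sum_fractParabola_le d
    refine ⟨_, (?_ : HasBoundedDiscrepancy α F (μ + w * (1 / 6)))⟩
    convert hμ.add_const_mul hφ w using 2
    ring

/-- Averaging the uniform bound over the starting point gives `N |∫ F - μ| ≤ C` for every `N`. -/
theorem HasBoundedDiscrepancy.eq_integral {α : ℝ} {F : ℝ → ℝ} {μ : ℝ}
    (h : HasBoundedDiscrepancy α F μ) (hF : Continuous F) (hper : Function.Periodic F 1) :
    μ = ∫ y in (0 : ℝ)..1, F y := by
  obtain ⟨C, hC⟩ := h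
  have hshift : ∀ s : ℝ, ∫ y in (0 : ℝ)..1, F (y + s) = ∫ y in (0 : ℝ)..1, F y := by
    intro s
    rw [intervalIntegral.integral_comp_add_right]
    have := hper.intervalIntegral_add_eq (0 + s) 0
    simpa [add_comm] using this
  have hbound : ∀ N : ℕ, N * |(∫ y in (0 : ℝ)..1, F y) - μ| ≤ C := by
    intro N
    have h1 : ∫ y in (0 : ℝ)..1, ∑ k ∈ Finset.range N, (F (y + k * α) - μ) =
        N * ((∫ y in (0 : ℝ)..1, F y) - μ) := by
      rw [intervalIntegral.integral_finsetSum fun k _ =>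
        (Continuous.intervalIntegrable (by fun_prop) _ _)]
      have : ∀ k ∈ Finset.range N, ∫ y in (0 : ℝ)..1, (F (y + k * α) - μ) =
          (∫ y in (0 : ℝ)..1, F y) - μ := by
        intro k _
        rw [intervalIntegral.integral_sub (Continuous.intervalIntegrable (by fun_prop) _ _)
          (by simp), hshift]
        simp
      rw [Finset.sum_congr rfl this]
      simp [mul_sub]
    have h2 := intervalIntegral.norm_integral_le_of_norm_le_const (a := (0 : ℝ)) (b := 1)
      (f := fun y => ∑ k ∈ Finset.range N, (F (y + k * α) - μ)) (C := C) (fun y _ => hC y N)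
    rw [h1] at h2
    simpa [abs_mul] using h2
  by_contra hne
  have hpos : 0 < |(∫ y in (0 : ℝ)..1, F y) - μ| := abs_pos.2 (sub_ne_zero.2 (Ne.symm hne))
  obtain ⟨N, hN⟩ := exists_nat_gt (C / |(∫ y in (0 : ℝ)..1, F y) - μ|)
  rw [div_lt_iff₀ hpos] at hN
  exact absurd (hbound N) (not_le.2 hN)

/-! ### Chord lengths of a region: continuity and local affineness -/

/-- The length (in the first coordinate) of the intersection of `U` with the line of slope `α`
and intercept `c`. -/
def chordLength (U : Set (ℝ × ℝ)) (α c : ℝ) : ℝ :=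
  ∫ u : ℝ, U.indicator (fun _ => (1 : ℝ)) (u, c + α * u)

/-- `U` is an open part of the unit square, and a preconnected set that avoids `B` lies inside `U`
or is disjoint from `U`. -/
structure IsRegionOff (B U : Set (ℝ × ℝ)) : Prop where
  isOpen : IsOpen U
  isOpen_outside : IsOpen {p | p ∉ U ∧ p ∉ B}
  subset : U ⊆ unitSquare
  dichotomy : ∀ C : Set (ℝ × ℝ), IsPreconnected C → Disjoint C B → C ⊆ U ∨ Disjoint C U

theorem measurable_line_indicator {U : Set (ℝ × ℝ)} (hU : MeasurableSet U) (α c : ℝ) :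
    Measurable fun u : ℝ => U.indicator (fun _ => (1 : ℝ)) (u, c + α * u) :=
  (measurable_const.indicator hU).comp (by fun_prop)

theorem norm_indicator_one_le {X : Type*} (U : Set X) (p : X) :
    ‖U.indicator (fun _ => (1 : ℝ)) p‖ ≤ 1 := by
  by_cases h : p ∈ U <;> simp [h]

theorem intervalIntegrable_of_measurable_of_norm_le {f : ℝ → ℝ} (hf : Measurable f)
    (hb : ∀ x, ‖f x‖ ≤ 1) (a b : ℝ) : IntervalIntegrable f volume a b := by
  rw [intervalIntegrable_iff]
  exact Measure.integrableOn_of_bounded (M := 1) (by simp) hf.aestronglyMeasurable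
    (Eventually.of_forall hb)

/-- Dominated convergence: off `B` the indicator of `U` is locally constant, and `B` meets the line
in a null set. -/
theorem IsRegionOff.continuous_chordLength {B U : Set (ℝ × ℝ)} (h : IsRegionOff B U) {α : ℝ}
    (hB : ∀ c, {u : ℝ | (u, c + α * u) ∈ B}.Countable) : Continuous (chordLength U α) := by
  rw [continuous_iff_continuousAt]
  intro c₀
  refine continuousAt_of_dominated (bound := (Icc (0 : ℝ) 1).indicator fun _ => (1 : ℝ))
    (Eventually.of_forall fun c =>
      (measurable_line_indicator h.isOpen.measurableSet α c).aestronglyMeasurable)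
    (Eventually.of_forall fun c => Eventually.of_forall fun u => ?_) ?_ ?_
  · by_cases hu : (u, c + α * u) ∈ U
    · have := (h.subset hu).1
      rw [indicator_of_mem (show u ∈ Icc (0 : ℝ) 1 from ⟨this.1, this.2.le⟩)]
      exact norm_indicator_one_le _ _
    · rw [indicator_of_notMem hu, norm_zero]
      exact indicator_nonneg (fun _ _ => zero_le_one (α := ℝ)) _
  · exact (integrable_indicator_iff measurableSet_Icc).2
      (integrableOn_const (by simp))
  · filter_upwards [(hB c₀).ae_notMem volume] with u hu
    have hc : Continuous fun c : ℝ => ((u, c + α * u) : ℝ × ℝ) := by fun_prop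
    by_cases hU : (u, c₀ + α * u) ∈ U
    · refine (continuousAt_const : ContinuousAt (fun _ : ℝ => (1 : ℝ)) c₀).congr ?_
      filter_upwards [hc.continuousAt.preimage_mem_nhds (h.isOpen.mem_nhds hU)] with c hc'
      exact (indicator_of_mem (show (u, c + α * u) ∈ U from hc') fun _ => (1 : ℝ)).symm
    · refine (continuousAt_const : ContinuousAt (fun _ : ℝ => (0 : ℝ)) c₀).congr ?_
      filter_upwards [hc.continuousAt.preimage_mem_nhds
        (h.isOpen_outside.mem_nhds ⟨hU, hu⟩)] with c hc'
      exact (indicator_of_notMem (show (u, c + α * u) ∉ U from hc'.1) fun _ => (1 : ℝ)).symm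

theorem convex_setOf_pos_affine (x y z : ℝ) :
    Convex ℝ {p : ℝ × ℝ | 0 < x * p.1 + y * p.2 + z} := by
  intro p hp q hq a b ha hb hab
  simp only [mem_ofPred_eq, Prod.fst_add, Prod.snd_add, Prod.smul_fst, Prod.smul_snd,
    smul_eq_mul] at *
  have : x * (a * p.1 + b * q.1) + y * (a * p.2 + b * q.2) + z =
      a * (x * p.1 + y * p.2 + z) + b * (x * q.1 + y * q.2 + z) := by
    linear_combination -z * hab
  rw [this]
  rcases ha.eq_or_lt with rfl | ha
  · have : b = 1 := by linarith
    rw [this]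
    linarith
  · have := mul_pos ha hp
    have := mul_nonneg hb hq.le
    linarith

/-- `g` is a polynomial function of degree at most one. -/
def IsAffineFun (g : ℝ → ℝ) : Prop := ∃ a b : ℝ, ∀ c, g c = a * c + b

theorem IsAffineFun.continuous {g : ℝ → ℝ} (hg : IsAffineFun g) : Continuous g := by
  obtain ⟨a, b, h⟩ := hg
  rw [show g = fun c => a * c + b from funext h]
  fun_prop

/-- The indicator of `U` is constant on a thin trapezoid between two consecutive edges. -/
theorem IsRegionOff.exists_eventually_indicator_eq {B U : Set (ℝ × ℝ)} (hU : IsRegionOff B U)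
    {α c₀ : ℝ} {ι : Type*} [Finite ι] {h : ι → ℝ → ℝ} (hh : ∀ i, IsAffineFun (h i))
    (hB : ∀ᶠ c in 𝓝 c₀, ∀ u, (u, c + α * u) ∈ B → ∃ i, u = h i c) {g₁ g₂ : ℝ → ℝ}
    (hg₁ : IsAffineFun g₁) (hg₂ : IsAffineFun g₂) (hlt : g₁ c₀ < g₂ c₀)
    (hcons : ∀ i, h i c₀ < g₁ c₀ ∨ h i = g₁ ∨ h i = g₂ ∨ g₂ c₀ < h i c₀) :
    ∃ σ : ℝ, ∀ᶠ c in 𝓝 c₀, g₁ c < g₂ c ∧ ∀ u, g₁ c < u → u < g₂ c →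
      U.indicator (fun _ => (1 : ℝ)) (u, c + α * u) = σ := by
  have hev : ∀ᶠ c in 𝓝 c₀, g₁ c < g₂ c ∧
      ∀ i, h i c < g₁ c ∨ h i = g₁ ∨ h i = g₂ ∨ g₂ c < h i c := by
    refine (hg₁.continuous.continuousAt.eventually_lt hg₂.continuous.continuousAt hlt).and ?_
    rw [eventually_all]
    intro i
    rcases hcons i with hi | hi | hi | hi
    · exact ((hh i).continuous.continuousAt.eventually_lt hg₁.continuous.continuousAt hi).mono
        fun c hc => Or.inl hc
    · exact Eventually.of_forall fun c => Or.inr (Or.inl hi)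
    · exact Eventually.of_forall fun c => Or.inr (Or.inr (Or.inl hi))
    · exact (hg₂.continuous.continuousAt.eventually_lt (hh i).continuous.continuousAt hi).mono
        fun c hc => Or.inr (Or.inr (Or.inr hc))
  obtain ⟨ε, hε, hball⟩ := Metric.eventually_nhds_iff.1 (hev.and hB)
  -- `T` is an intersection of four open half-planes, hence connected, and it avoids `B`; the
  -- dichotomy then decides the indicator on all of it.
  set T : Set (ℝ × ℝ) := {p | dist (p.2 - α * p.1) c₀ < ε ∧ g₁ (p.2 - α * p.1) < p.1 ∧
    p.1 < g₂ (p.2 - α * p.1)} with hT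
  have hconv : Convex ℝ T := by
    obtain ⟨a₁, b₁, h₁⟩ := hg₁
    obtain ⟨a₂, b₂, h₂⟩ := hg₂
    have : T = (({p : ℝ × ℝ | 0 < (-α) * p.1 + 1 * p.2 + (ε - c₀)} ∩
        {p : ℝ × ℝ | 0 < α * p.1 + (-1) * p.2 + (ε + c₀)}) ∩
        {p : ℝ × ℝ | 0 < (1 + a₁ * α) * p.1 + (-a₁) * p.2 + (-b₁)}) ∩
        {p : ℝ × ℝ | 0 < (-1 - a₂ * α) * p.1 + a₂ * p.2 + b₂} := by
      ext p
      simp only [hT, mem_ofPred_eq, mem_inter_iff, Real.dist_eq, abs_lt, h₁, h₂]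
      constructor
      · rintro ⟨⟨h1, h2⟩, h3, h4⟩
        exact ⟨⟨⟨by linarith, by linarith⟩, by linarith⟩, by linarith⟩
      · rintro ⟨⟨⟨h1, h2⟩, h3⟩, h4⟩
        exact ⟨⟨by linarith, by linarith⟩, by linarith, by linarith⟩
    rw [this]
    exact (((convex_setOf_pos_affine _ _ _).inter (convex_setOf_pos_affine _ _ _)).inter
      (convex_setOf_pos_affine _ _ _)).inter (convex_setOf_pos_affine _ _ _)
  have hdisj : Disjoint T B := by
    rw [disjoint_left]
    rintro ⟨u, y⟩ ⟨h1, h2, h3⟩ hp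
    obtain ⟨⟨-, h4⟩, h5⟩ := hball h1
    simp only at h2 h3 h4 h5
    obtain ⟨i, hui⟩ := h5 u (by simpa using hp)
    rcases h4 i with hi | hi | hi | hi
    · linarith
    · rw [hi] at hui
      linarith
    · rw [hi] at hui
      linarith
    · linarith
  have hmemT : ∀ c, dist c c₀ < ε → ∀ u, g₁ c < u → u < g₂ c → (u, c + α * u) ∈ T := by
    intro c hc u h1 h2
    simp only [hT, mem_ofPred_eq, add_sub_cancel_right]
    exact ⟨hc, h1, h2⟩
  rcases hU.dichotomy T hconv.isPreconnected hdisj with hTU | hTU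
  · refine ⟨1, Metric.eventually_nhds_iff.2 ⟨ε, hε, fun c hc => ⟨(hball hc).1.1, ?_⟩⟩⟩
    exact fun u h1 h2 => indicator_of_mem (hTU (hmemT c hc u h1 h2)) _
  · refine ⟨0, Metric.eventually_nhds_iff.2 ⟨ε, hε, fun c hc => ⟨(hball hc).1.1, ?_⟩⟩⟩
    exact fun u h1 h2 => indicator_of_notMem (disjoint_left.1 hTU (hmemT c hc u h1 h2)) _

theorem IsRegionOff.exists_eventually_integral_eq {B U : Set (ℝ × ℝ)} (hU : IsRegionOff B U)
    {α c₀ : ℝ} {ι : Type*} [Finite ι] {h : ι → ℝ → ℝ} (hh : ∀ i, IsAffineFun (h i))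
    (hB : ∀ᶠ c in 𝓝 c₀, ∀ u, (u, c + α * u) ∈ B → ∃ i, u = h i c) {g₁ g₂ : ℝ → ℝ}
    (hg₁ : IsAffineFun g₁) (hg₂ : IsAffineFun g₂) (hlt : g₁ c₀ < g₂ c₀)
    (hcons : ∀ i, h i c₀ < g₁ c₀ ∨ h i = g₁ ∨ h i = g₂ ∨ g₂ c₀ < h i c₀) :
    ∃ a b : ℝ, ∀ᶠ c in 𝓝 c₀,
      ∫ u in g₁ c..g₂ c, U.indicator (fun _ => (1 : ℝ)) (u, c + α * u) = a * c + b := by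
  obtain ⟨σ, hσ⟩ := hU.exists_eventually_indicator_eq hh hB hg₁ hg₂ hlt hcons
  obtain ⟨a₁, b₁, h₁⟩ := hg₁
  obtain ⟨a₂, b₂, h₂⟩ := hg₂
  refine ⟨σ * (a₂ - a₁), σ * (b₂ - b₁), ?_⟩
  filter_upwards [hσ] with c ⟨hc1, hc2⟩
  have : ∫ u in g₁ c..g₂ c, U.indicator (fun _ => (1 : ℝ)) (u, c + α * u) =
      ∫ _ in g₁ c..g₂ c, σ := by
    rw [intervalIntegral.integral_of_le hc1.le, intervalIntegral.integral_of_le hc1.le,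
      integral_Ioc_eq_integral_Ioo, integral_Ioc_eq_integral_Ioo]
    exact setIntegral_congr_fun measurableSet_Ioo fun u hu => hc2 u hu.1 hu.2
  rw [this, intervalIntegral.integral_const, h₁, h₂, smul_eq_mul]
  ring

/-- Induction on the number of crossings below `g`: the strip between the last such crossing and `g`
is split off. Injectivity at `c₀` ensures that no two edges cross the line at the same point. -/
theorem IsRegionOff.exists_eventually_integral_from_eq {B U : Set (ℝ × ℝ)}
    (hU : IsRegionOff B U) {α c₀ : ℝ} {ι : Type*} [Fintype ι] {h : ι → ℝ → ℝ}
    (hh : ∀ i, IsAffineFun (h i))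
    (hB : ∀ᶠ c in 𝓝 c₀, ∀ u, (u, c + α * u) ∈ B → ∃ i, u = h i c)
    (hinj : Function.Injective fun i => h i c₀) {L : ℝ} (hL : ∀ i, L < h i c₀) (n : ℕ) :
    ∀ g : ℝ → ℝ, IsAffineFun g → L < g c₀ → (∀ i, h i c₀ ≠ g c₀ ∨ h i = g) →
      (Finset.univ.filter fun i => h i c₀ < g c₀).card = n →
      ∃ a b : ℝ, ∀ᶠ c in 𝓝 c₀,
        ∫ u in L..g c, U.indicator (fun _ => (1 : ℝ)) (u, c + α * u) = a * c + b := by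
  induction n using Nat.strong_induction_on with
  | _ n ih =>
    intro g hg hLg hgi hn
    have habove : ∀ i, ¬ h i c₀ < g c₀ → h i = g ∨ g c₀ < h i c₀ := by
      intro i hi
      rcases hgi i with h1 | h1
      · exact Or.inr (lt_of_le_of_ne (not_lt.1 hi) h1.symm)
      · exact Or.inl h1
    rcases (Finset.univ.filter fun i => h i c₀ < g c₀).eq_empty_or_nonempty with he | hne
    · refine hU.exists_eventually_integral_eq hh hB (g₁ := fun _ => L) ⟨0, L, by simp⟩ hg hLg
        fun i => Or.inr (Or.inr (habove i fun hi => ?_))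
      have : i ∈ Finset.univ.filter fun i => h i c₀ < g c₀ := by simpa using hi
      rw [he] at this
      simp at this
    · obtain ⟨j, hj, hmax⟩ := Finset.exists_max_image _ (fun i => h i c₀) hne
      have hjg : h j c₀ < g c₀ := by simpa using hj
      obtain ⟨a, b, hab⟩ := ih (Finset.univ.filter fun i => h i c₀ < h j c₀).card (by
          rw [← hn]
          refine Finset.card_lt_card (Finset.ssubset_iff_subset_ne.2 ⟨fun i hi => ?_, fun he => ?_⟩)
          · simp only [Finset.mem_filter_univ] at hi ⊢
            exact hi.trans hjg
          · rw [← he] at hj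
            simp at hj) (h j) (hh j) (hL j) (fun i => by
          by_cases hij : i = j
          · exact Or.inr (by rw [hij])
          · exact Or.inl fun he => hij (hinj he)) rfl
      obtain ⟨a', b', hab'⟩ := hU.exists_eventually_integral_eq hh hB (hh j) hg hjg (fun i => by
        by_cases hi : h i c₀ < g c₀
        · have := hmax i (by simpa using hi)
          rcases this.lt_or_eq with h1 | h1
          · exact Or.inl h1
          · exact Or.inr (Or.inl (by rw [hinj h1]))
        · exact Or.inr (Or.inr (habove i hi)))
      refine ⟨a + a', b + b', ?_⟩
      filter_upwards [hab, hab'] with c hc hc'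
      have hint := intervalIntegrable_of_measurable_of_norm_le
        (measurable_line_indicator hU.isOpen.measurableSet α c)
        (fun u => norm_indicator_one_le _ _)
      rw [← intervalIntegral.integral_add_adjacent_intervals (hint L (h j c)) (hint (h j c) (g c)),
        hc, hc']
      ring

theorem IsRegionOff.isLocallyQuadraticAt_chordLength {B U : Set (ℝ × ℝ)}
    (hU : IsRegionOff B U) {α c₀ : ℝ} {ι : Type*} [Finite ι] {h : ι → ℝ → ℝ}
    (hh : ∀ i, IsAffineFun (h i))
    (hB : ∀ᶠ c in 𝓝 c₀, ∀ u, (u, c + α * u) ∈ B → ∃ i, u = h i c)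
    (hinj : Function.Injective fun i => h i c₀) :
    IsLocallyQuadraticAt 0 (chordLength U α) c₀ := by
  have := Fintype.ofFinite ι
  -- `|M| + 1` exceeds every crossing and is at least `1`, so the interval also covers the unit
  -- square; the absolute value matters when there are no crossings and `M` is arbitrary.
  obtain ⟨M, hM⟩ := Finite.bddAbove_range fun i => |h i c₀|
  have hM' : ∀ i, |h i c₀| < |M| + 1 := fun i =>
    lt_of_le_of_lt ((hM (mem_range_self i)).trans (le_abs_self M)) (lt_add_one _)
  obtain ⟨a, b, hab⟩ := hU.exists_eventually_integral_from_eq hh hB hinj (L := -(|M| + 1))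
    (fun i => (abs_lt.1 (hM' i)).1) _ (fun _ => |M| + 1) ⟨0, |M| + 1, by simp⟩
    (by have := abs_nonneg M; linarith) (fun i => Or.inl (abs_lt.1 (hM' i)).2.ne) rfl
  refine ⟨a, b, hab.mono fun c hc => ?_⟩
  rw [zero_mul, zero_add, ← hc, chordLength, intervalIntegral.integral_eq_integral_of_support_subset]
  intro u hu
  have hmem : (u, c + α * u) ∈ U := by
    by_contra hn
    exact hu (indicator_of_notMem hn _)
  have := (hU.subset hmem).1
  have := abs_nonneg M
  exact ⟨by linarith [this, (hU.subset hmem).1.1], by linarith [(hU.subset hmem).1.2]⟩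

/-! ### Polygons as regions off their boundary chain -/

variable {n : ℕ}

theorem mem_polygon_boundary_iff {P : Polygon (ℝ × ℝ) n} {p : ℝ × ℝ} :
    p ∈ P.boundary ℝ ↔ ∃ i, ∃ s ∈ Icc (0 : ℝ) 1, P.edgePath ℝ i s = p := by
  simp only [Polygon.boundary, mem_iUnion, Polygon.edgeSet_eq_image_edgePath, mem_image]

theorem isClosed_polygon_boundary (P : Polygon (ℝ × ℝ) n) : IsClosed (P.boundary ℝ) := by
  refine isClosed_iUnion_of_finite fun i => ?_
  rw [Polygon.edgeSet_eq_image_edgePath]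
  exact (isCompact_Icc.image (AffineMap.lineMap_continuous (R := ℝ))).isClosed

theorem connectedComponentIn_subset_polygonInside {P : Polygon (ℝ × ℝ) n} {p : ℝ × ℝ}
    (hp : p ∈ polygonInside P) :
    connectedComponentIn (P.boundary ℝ)ᶜ p ⊆ polygonInside P := by
  intro q hq
  refine ⟨connectedComponentIn_subset _ _ hq, ?_⟩
  rw [← connectedComponentIn_eq hq]
  exact hp.2

/-- The inside is a union of components of the complement of a closed set, and these components are
open. -/
theorem isRegionOff_polygonInside {P : Polygon (ℝ × ℝ) n} (h : polygonInside P ⊆ unitSquare) :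
    IsRegionOff (P.boundary ℝ) (polygonInside P) where
  isOpen := by
    rw [isOpen_iff_mem_nhds]
    intro p hp
    exact mem_of_superset
      ((isClosed_polygon_boundary P).isOpen_compl.connectedComponentIn.mem_nhds
        (mem_connectedComponentIn hp.1)) (connectedComponentIn_subset_polygonInside hp)
  isOpen_outside := by
    rw [isOpen_iff_mem_nhds]
    rintro p ⟨hp, hpB⟩
    refine mem_of_superset
      ((isClosed_polygon_boundary P).isOpen_compl.connectedComponentIn.mem_nhds
        (mem_connectedComponentIn hpB)) fun q hq => ⟨fun hqU => hp ?_, ?_⟩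
    · refine connectedComponentIn_subset_polygonInside hqU ?_
      rw [← connectedComponentIn_eq hq]
      exact mem_connectedComponentIn hpB
    · exact connectedComponentIn_subset _ _ hq
  subset := h
  dichotomy := by
    intro C hC hdisj
    by_cases hCU : Disjoint C (polygonInside P)
    · exact Or.inr hCU
    · obtain ⟨p, hpC, hpU⟩ := not_disjoint_iff.1 hCU
      exact Or.inl ((hC.subset_connectedComponentIn hpC
        (subset_compl_iff_disjoint_right.2 hdisj)).trans
          (connectedComponentIn_subset_polygonInside hpU))

/-- The intercept of the line of slope `α` through `p`. -/
def intercept (α : ℝ) (p : ℝ × ℝ) : ℝ := p.2 - α * p.1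

/-- The parameter at which the line containing the `i`-th edge has intercept `c`. -/
def edgeParam (P : Polygon (ℝ × ℝ) n) (α : ℝ) (i : Fin n) (c : ℝ) : ℝ :=
  (c - intercept α (P i)) / (intercept α (P (finRotate n i)) - intercept α (P i))

/-- The first coordinate of the point with intercept `c` on the line containing the `i`-th edge. -/
def edgeGraph (P : Polygon (ℝ × ℝ) n) (α : ℝ) (i : Fin n) (c : ℝ) : ℝ :=
  (P i).1 + edgeParam P α i c * ((P (finRotate n i)).1 - (P i).1)

/-- Equal intercepts mean slope `α` or a degenerate edge; simplicity excludes the latter. -/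
theorem intercept_ne_of_simple {P : Polygon (ℝ × ℝ) n} (hP : PolygonIsSimple P) {α : ℝ}
    {i : Fin n} (h : ¬ SegmentHasSlope (P i) (P (finRotate n i)) α) :
    intercept α (P (finRotate n i)) - intercept α (P i) ≠ 0 := by
  intro h0
  simp only [intercept] at h0
  by_cases h1 : (P i).1 = (P (finRotate n i)).1
  · have h2 : P i = P (finRotate n i) := by
      refine Prod.ext h1 ?_
      rw [h1] at h0
      linarith
    have := (hP.2 i i 0 (1 / 2) (by norm_num) (by norm_num) (by
      simp [Polygon.edgePath, h2])).2
    norm_num at this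
  · exact h ⟨h1, by linarith⟩

theorem edgePath_fst (P : Polygon (ℝ × ℝ) n) (i : Fin n) (s : ℝ) :
    (P.edgePath ℝ i s).1 = (P i).1 + s * ((P (finRotate n i)).1 - (P i).1) := by
  simp [Polygon.edgePath, AffineMap.lineMap_apply, add_comm]

theorem edgePath_snd (P : Polygon (ℝ × ℝ) n) (i : Fin n) (s : ℝ) :
    (P.edgePath ℝ i s).2 = (P i).2 + s * ((P (finRotate n i)).2 - (P i).2) := by
  simp [Polygon.edgePath, AffineMap.lineMap_apply, add_comm]

section

variable {P : Polygon (ℝ × ℝ) n} {α : ℝ}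

theorem edgeParam_eq_of_edgePath_eq {i : Fin n}
    (h : intercept α (P (finRotate n i)) - intercept α (P i) ≠ 0) {s u c : ℝ}
    (hs : P.edgePath ℝ i s = (u, c + α * u)) : s = edgeParam P α i c ∧ u = edgeGraph P α i c := by
  have h1 := congrArg Prod.fst hs
  have h2 := congrArg Prod.snd hs
  rw [edgePath_fst] at h1
  rw [edgePath_snd] at h2
  simp only at h1 h2
  have hse : s = edgeParam P α i c := by
    rw [edgeParam, eq_div_iff h]
    simp only [intercept]
    linear_combination h2 - α * h1
  exact ⟨hse, by rw [edgeGraph, ← hse, h1]⟩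

theorem edgePath_edgeParam {i : Fin n}
    (h : intercept α (P (finRotate n i)) - intercept α (P i) ≠ 0) (c : ℝ) :
    P.edgePath ℝ i (edgeParam P α i c) = (edgeGraph P α i c, c + α * edgeGraph P α i c) := by
  have hs : edgeParam P α i c * (intercept α (P (finRotate n i)) - intercept α (P i)) =
      c - intercept α (P i) := by
    rw [edgeParam, div_mul_cancel₀ _ h]
  refine Prod.ext ?_ ?_
  · rw [edgePath_fst, edgeGraph]
  · rw [edgePath_snd, edgeGraph]
    simp only [intercept] at hs
    linear_combination hs

theorem isAffineFun_edgeGraph (i : Fin n) : IsAffineFun (edgeGraph P α i) := by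
  refine ⟨((P (finRotate n i)).1 - (P i).1) /
    (intercept α (P (finRotate n i)) - intercept α (P i)),
    (P i).1 - intercept α (P i) * ((P (finRotate n i)).1 - (P i).1) /
    (intercept α (P (finRotate n i)) - intercept α (P i)), fun c => ?_⟩
  simp only [edgeGraph, edgeParam]
  ring

theorem continuous_edgeParam (i : Fin n) : Continuous (edgeParam P α i) := by
  unfold edgeParam
  fun_prop

theorem countable_setOf_line_mem_boundary (hP : PolygonIsSimple P)
    (hα : ∀ i : Fin n, ¬ SegmentHasSlope (P i) (P (finRotate n i)) α) (c : ℝ) :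
    {u : ℝ | (u, c + α * u) ∈ P.boundary ℝ}.Countable := by
  refine (countable_range fun i => edgeGraph P α i c).mono fun u hu => ?_
  obtain ⟨i, s, -, his⟩ := mem_polygon_boundary_iff.1 hu
  exact ⟨i, (edgeParam_eq_of_edgePath_eq (intercept_ne_of_simple hP (hα i)) his).2.symm⟩

theorem isLocallyQuadraticAt_chordLength_polygonInside (hP : PolygonIsSimple P)
    (hα : ∀ i : Fin n, ¬ SegmentHasSlope (P i) (P (finRotate n i)) α)
    (h : polygonInside P ⊆ unitSquare) {c₀ : ℝ} (hc₀ : ∀ i, c₀ ≠ intercept α (P i)) :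
    IsLocallyQuadraticAt 0 (chordLength (polygonInside P) α) c₀ := by
  have hne := fun i => intercept_ne_of_simple hP (hα i)
  have h0 : ∀ i, edgeParam P α i c₀ ≠ 0 := by
    intro i
    rw [edgeParam, Ne, div_eq_zero_iff, sub_eq_zero]
    exact not_or.2 ⟨hc₀ i, hne i⟩
  have h1 : ∀ i, edgeParam P α i c₀ ≠ 1 := by
    intro i hi
    rw [edgeParam, div_eq_one_iff_eq (hne i)] at hi
    exact hc₀ (finRotate n i) (by linarith)
  refine (isRegionOff_polygonInside h).isLocallyQuadraticAt_chordLength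
    (ι := {i : Fin n // edgeParam P α i c₀ ∈ Ioo (0 : ℝ) 1})
    (h := fun i => edgeGraph P α i) (fun i => isAffineFun_edgeGraph _) ?_ ?_
  · have hev : ∀ᶠ c in 𝓝 c₀, ∀ i, edgeParam P α i c₀ ∉ Ioo (0 : ℝ) 1 →
        edgeParam P α i c ∉ Icc (0 : ℝ) 1 := by
      rw [eventually_all]
      intro i
      by_cases hi : edgeParam P α i c₀ ∈ Ioo (0 : ℝ) 1
      · exact Eventually.of_forall fun c hc => absurd hi hc
      · have hi' : edgeParam P α i c₀ ∉ Icc (0 : ℝ) 1 := fun hm =>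
          hi ⟨lt_of_le_of_ne hm.1 (h0 i).symm, lt_of_le_of_ne hm.2 (h1 i)⟩
        filter_upwards [(continuous_edgeParam i).continuousAt.preimage_mem_nhds
          (isClosed_Icc.isOpen_compl.mem_nhds hi')] with c hc _ using hc
    filter_upwards [hev] with c hc u hu
    obtain ⟨i, s, hs, his⟩ := mem_polygon_boundary_iff.1 hu
    obtain ⟨rfl, hu'⟩ := edgeParam_eq_of_edgePath_eq (hne i) his
    exact ⟨⟨i, by_contra fun hi => hc i hi hs⟩, hu'⟩
  · rintro ⟨i, hi⟩ ⟨j, hj⟩ hij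
    simp only at hij
    have := hP.2 i j _ _ (Ioo_subset_Ico_self hi) (Ioo_subset_Ico_self hj) (by
      rw [edgePath_edgeParam (hne i), edgePath_edgeParam (hne j), hij])
    exact Subtype.ext this.1

end

theorem volume_polygon_boundary (P : Polygon (ℝ × ℝ) n) : volume (P.boundary ℝ) = 0 := by
  refine measure_iUnion_null fun i => ?_
  refine measure_mono_null (t := (line[ℝ, P i, P (finRotate n i)] : Set (ℝ × ℝ))) ?_ ?_
  · rintro p ⟨s, -, rfl⟩
    exact AffineMap.lineMap_mem_affineSpan_pair _ _ _
  · refine Measure.addHaar_affineSubspace _ _ fun htop => ?_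
    have h1 := (collinear_pair ℝ (P i) (P (finRotate n i))).finrank_le_one
    rw [← direction_affineSpan, htop, AffineSubspace.direction_top, finrank_top] at h1
    simp at h1

/-! ### The return time function -/

/-- The time spent in `U` by the flow line of slope `α` from `(0, z)` up to its return to the
vertical side. -/
def returnTime (U : Set (ℝ × ℝ)) (α z : ℝ) : ℝ :=
  ∫ u in (0 : ℝ)..1, U.indicator (fun _ => (1 : ℝ)) (u, Int.fract (z + α * u))

theorem measurable_indicator_fract {U : Set (ℝ × ℝ)} (hU : MeasurableSet U) :
    Measurable fun p : ℝ × ℝ => U.indicator (fun _ => (1 : ℝ)) (p.1, Int.fract p.2) :=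
  (measurable_const.indicator hU).comp (measurable_fst.prodMk measurable_snd.fract)

theorem returnTime_periodic (U : Set (ℝ × ℝ)) (α : ℝ) :
    Function.Periodic (returnTime U α) 1 := fun z => by
  simp only [returnTime, add_right_comm z 1, Int.fract_add_one]

theorem chordLength_eq_intervalIntegral {U : Set (ℝ × ℝ)} (hU : U ⊆ unitSquare) (α c : ℝ) :
    chordLength U α c = ∫ u in (0 : ℝ)..1, U.indicator (fun _ => (1 : ℝ)) (u, c + α * u) := by
  rw [chordLength, intervalIntegral.integral_of_le zero_le_one, integral_Ioc_eq_integral_Ioo,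
    ← integral_Ico_eq_integral_Ioo, setIntegral_eq_integral_of_forall_compl_eq_zero]
  intro u hu
  exact indicator_of_notMem (fun h => hu (hU h).1) _

theorem indicator_fract_eq_sum {U : Set (ℝ × ℝ)} (hU : U ⊆ unitSquare) {K : ℕ} {u y : ℝ}
    (hy : |y| < K) :
    U.indicator (fun _ => (1 : ℝ)) (u, Int.fract y) =
      ∑ k ∈ Finset.Icc (-(K : ℤ)) K, U.indicator (fun _ => (1 : ℝ)) (u, y - k) := by
  rw [Finset.sum_eq_single ⌊y⌋]
  · rfl
  · intro k _ hk
    refine indicator_of_notMem (fun h => hk ?_) _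
    have := (hU h).2
    symm
    rw [Int.floor_eq_iff]
    simp only [mem_Ico] at this
    constructor <;> linarith
  · intro h
    refine absurd ?_ h
    rw [abs_lt] at hy
    rw [Finset.mem_Icc]
    constructor
    · rw [Int.le_floor]
      push_cast
      exact hy.1.le
    · have h1 : (⌊y⌋ : ℝ) < K := (Int.floor_le y).trans_lt hy.2
      exact_mod_cast h1.le

/-- Unfolding the torus vertically: the wrapped segment is a union of plane chords, one for each
integer part of the height, which `K` bounds. -/
theorem returnTime_eq_sum {U : Set (ℝ × ℝ)} (hU : U ⊆ unitSquare) (hUm : MeasurableSet U)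
    {α z : ℝ} {K : ℕ} (hK : |z| + |α| < K) :
    returnTime U α z = ∑ k ∈ Finset.Icc (-(K : ℤ)) K, chordLength U α (z - k) := by
  simp only [chordLength_eq_intervalIntegral hU]
  rw [← intervalIntegral.integral_finsetSum
    (f := fun (k : ℤ) (u : ℝ) => U.indicator (fun _ => (1 : ℝ)) (u, z - k + α * u))
    fun k _ => intervalIntegrable_of_measurable_of_norm_le
      (measurable_line_indicator hUm α (z - k)) (fun u => norm_indicator_one_le _ _) _ _]
  refine intervalIntegral.integral_congr fun u hu => ?_
  rw [uIcc_of_le zero_le_one] at hu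
  have hy : |z + α * u| < K := by
    refine (abs_add_le _ _).trans_lt (lt_of_le_of_lt ?_ hK)
    rw [abs_mul, abs_of_nonneg hu.1]
    have := mul_le_mul_of_nonneg_left hu.2 (abs_nonneg α)
    linarith
  simp only [indicator_fract_eq_sum hU hy, add_sub_right_comm]

theorem eventually_returnTime_eq_sum {U : Set (ℝ × ℝ)} (hU : U ⊆ unitSquare)
    (hUm : MeasurableSet U) (α z₀ : ℝ) :
    ∃ s : Finset ℤ, ∀ᶠ z in 𝓝 z₀, returnTime U α z = ∑ k ∈ s, chordLength U α (z - k) := by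
  obtain ⟨K, hK⟩ := exists_nat_gt (|z₀| + 1 + |α|)
  refine ⟨Finset.Icc (-(K : ℤ)) K, ?_⟩
  have : ∀ᶠ z in 𝓝 z₀, |z| < |z₀| + 1 :=
    continuous_abs.continuousAt.eventually_lt continuousAt_const (lt_add_one |z₀|)
  filter_upwards [this] with z hz
  exact returnTime_eq_sum hU hUm (by linarith)

theorem continuous_returnTime {U : Set (ℝ × ℝ)} (hU : U ⊆ unitSquare) (hUm : MeasurableSet U)
    {α : ℝ} (hc : Continuous (chordLength U α)) : Continuous (returnTime U α) := by
  rw [continuous_iff_continuousAt]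
  intro z₀
  obtain ⟨s, hs⟩ := eventually_returnTime_eq_sum hU hUm α z₀
  refine ContinuousAt.congr ?_ (EventuallyEq.symm hs)
  exact Continuous.continuousAt (by fun_prop)

theorem IsLocallyQuadraticAt.comp_sub {F : ℝ → ℝ} {z d : ℝ} (h : IsLocallyQuadraticAt 0 F (z - d)) :
    IsLocallyQuadraticAt 0 (fun y => F (y - d)) z := by
  obtain ⟨a, b, hab⟩ := h
  refine ⟨a, b - a * d, ?_⟩
  filter_upwards [(continuous_sub_right d).continuousAt.eventually hab] with y hy
  rw [hy]
  ring

theorem IsLocallyQuadraticAt.sum {ι : Type*} {F : ι → ℝ → ℝ} {z : ℝ} (s : Finset ι)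
    (h : ∀ i ∈ s, IsLocallyQuadraticAt 0 (F i) z) :
    IsLocallyQuadraticAt 0 (fun y => ∑ i ∈ s, F i y) z := by
  classical
  induction s using Finset.induction_on with
  | empty => exact ⟨0, 0, by simp⟩
  | insert i s hi ih =>
    simp only [Finset.sum_insert hi]
    simpa using (h i (by simp)).add (ih fun j hj => h j (by simp [hj]))

theorem isLocallyQuadraticAt_returnTime {U : Set (ℝ × ℝ)} (hU : U ⊆ unitSquare)
    (hUm : MeasurableSet U) {α z : ℝ}
    (h : ∀ k : ℤ, IsLocallyQuadraticAt 0 (chordLength U α) (z - k)) :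
    IsLocallyQuadraticAt 0 (returnTime U α) z := by
  obtain ⟨s, hs⟩ := eventually_returnTime_eq_sum hU hUm α z
  obtain ⟨a, b, hab⟩ := IsLocallyQuadraticAt.sum s fun k _ => (h k).comp_sub
  exact ⟨a, b, by filter_upwards [hs, hab] with y hy hy' using hy.trans hy'⟩

/-- Fubini: for fixed `u` the shift by `α u` preserves the integral over a period, which leaves the
vertical slice of `U`. -/
theorem integral_returnTime {U : Set (ℝ × ℝ)} (hU : U ⊆ unitSquare) (hUm : MeasurableSet U)
    (α : ℝ) : ∫ z in (0 : ℝ)..1, returnTime U α z = volume.real U := by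
  have hmeas : Measurable (Function.uncurry fun z u : ℝ =>
      U.indicator (fun _ => (1 : ℝ)) (u, Int.fract (z + α * u))) :=
    (measurable_indicator_fract hUm).comp
      (measurable_snd.prodMk (measurable_fst.add (measurable_snd.const_mul α)))
  have hswap : ∫ z in (0 : ℝ)..1, returnTime U α z = ∫ u in (0 : ℝ)..1, ∫ z in (0 : ℝ)..1,
      U.indicator (fun _ => (1 : ℝ)) (u, Int.fract (z + α * u)) := by
    simp only [returnTime, intervalIntegral.integral_of_le zero_le_one]
    refine integral_integral_swap ?_
    exact Integrable.of_bound hmeas.aestronglyMeasurable 1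
      (Eventually.of_forall fun p => norm_indicator_one_le _ _)
  have hinner : ∀ u : ℝ, ∫ z in (0 : ℝ)..1,
      U.indicator (fun _ => (1 : ℝ)) (u, Int.fract (z + α * u)) =
      ∫ y, U.indicator (fun _ => (1 : ℝ)) (u, y) := by
    intro u
    rw [intervalIntegral.integral_comp_add_right
      fun y => U.indicator (fun _ => (1 : ℝ)) (u, Int.fract y)]
    have hper : Function.Periodic
        (fun y : ℝ => U.indicator (fun _ => (1 : ℝ)) (u, Int.fract y)) 1 := fun y => by simp
    have := hper.intervalIntegral_add_eq (α * u) 0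
    rw [zero_add (1 : ℝ)] at this
    rw [zero_add, add_comm (1 : ℝ), this, intervalIntegral.integral_of_le zero_le_one, integral_Ioc_eq_integral_Ioo,
      ← integral_Ico_eq_integral_Ioo,
      setIntegral_congr_fun (g := fun y => U.indicator (fun _ => (1 : ℝ)) (u, y)) measurableSet_Ico
        (fun y hy => by simp only [Int.fract_eq_self.2 hy]),
      setIntegral_eq_integral_of_forall_compl_eq_zero]
    intro y hy
    exact indicator_of_notMem (fun h => hy (hU h).2) _
  rw [hswap]
  simp only [hinner]
  have hvol : volume U ≠ ⊤ := by
    refine ne_top_of_le_ne_top ?_ (measure_mono hU)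
    rw [unitSquare, Measure.volume_eq_prod, Measure.prod_prod]
    simp
  have hint : Integrable (U.indicator fun _ => (1 : ℝ)) (volume.prod volume) :=
    (integrable_indicator_iff hUm).2 (integrableOn_const hvol)
  rw [intervalIntegral.integral_of_le zero_le_one, integral_Ioc_eq_integral_Ioo,
    ← integral_Ico_eq_integral_Ioo, setIntegral_eq_integral_of_forall_compl_eq_zero]
  · rw [← integral_prod _ hint, ← Measure.volume_eq_prod]
    exact integral_indicator_one hUm
  · intro u hu
    refine integral_eq_zero_of_ae (Eventually.of_forall fun y => ?_)
    exact indicator_of_notMem (fun h => hu (hU h).1) _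

/-! ### From the return time to the continuous flow -/

/-- The indicator of `U` along the flow line through `(0, c)`. -/
def flowIndicator (U : Set (ℝ × ℝ)) (α c s : ℝ) : ℝ :=
  U.indicator (fun _ => (1 : ℝ)) (Int.fract s, Int.fract (c + α * s))

theorem measurable_flowIndicator {U : Set (ℝ × ℝ)} (hU : MeasurableSet U) (α c : ℝ) :
    Measurable (flowIndicator U α c) :=
  (measurable_const.indicator hU).comp
    (measurable_id.fract.prodMk (measurable_const.add (measurable_id.const_mul α)).fract)

theorem integral_flowIndicator_add_nat (U : Set (ℝ × ℝ)) (α c : ℝ) (k : ℕ) :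
    ∫ s in (k : ℝ)..((k + 1 : ℕ) : ℝ), flowIndicator U α c s = returnTime U α (c + k * α) := by
  have h := intervalIntegral.integral_comp_add_right (a := 0) (b := 1) (flowIndicator U α c) (k : ℝ)
  rw [zero_add] at h
  rw [Nat.cast_add_one, add_comm (k : ℝ) 1, ← h, returnTime,
    intervalIntegral.integral_of_le zero_le_one, intervalIntegral.integral_of_le zero_le_one,
    integral_Ioc_eq_integral_Ioo, integral_Ioc_eq_integral_Ioo]
  refine setIntegral_congr_fun measurableSet_Ioo fun u hu => ?_
  simp only [flowIndicator, Int.fract_add_natCast, Int.fract_eq_self.2 ⟨hu.1.le, hu.2⟩]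
  ring_nf

theorem abs_integral_flowIndicator_le (U : Set (ℝ × ℝ)) (α c a b : ℝ) :
    |∫ s in a..b, flowIndicator U α c s| ≤ |b - a| := by
  simpa using intervalIntegral.norm_integral_le_of_norm_le_const (a := a) (b := b)
    (f := flowIndicator U α c) (C := 1) (fun s _ => norm_indicator_one_le _ _)

theorem volume_real_le_one_of_subset {U : Set (ℝ × ℝ)} (hU : U ⊆ unitSquare) :
    volume.real U ≤ 1 := by
  have h1 : volume unitSquare = 1 := by
    rw [unitSquare, Measure.volume_eq_prod, Measure.prod_prod]
    simp
  have h2 := measureReal_mono (μ := volume) hU (by rw [h1]; simp)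
  rwa [Measure.real, Measure.real, h1, ENNReal.toReal_one] at h2

theorem exists_abs_integral_flowIndicator_sub_le {U : Set (ℝ × ℝ)} (hU : U ⊆ unitSquare)
    (hUm : MeasurableSet U) {α : ℝ}
    (h : HasBoundedDiscrepancy α (returnTime U α) (volume.real U)) :
    ∃ C : ℝ, ∀ c a T : ℝ, a ∈ Ico (0 : ℝ) 1 → 0 < T →
      |(∫ s in a..(a + T), flowIndicator U α c s) - T * volume.real U| ≤ C := by
  obtain ⟨C, hC⟩ := h
  -- Besides the `⌊T⌋₊` complete returns, the initial piece costs at most `1`, the final piece at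
  -- most `2`, and the fractional part of `T` times the area at most `1`.
  refine ⟨C + 4, fun c a T ha hT => ?_⟩
  set N := ⌊T⌋₊ with hN
  have hN1 : (N : ℝ) ≤ T := Nat.floor_le hT.le
  have hN2 : T < N + 1 := Nat.lt_floor_add_one T
  have hint := intervalIntegrable_of_measurable_of_norm_le (measurable_flowIndicator hUm α c)
    (fun s => norm_indicator_one_le _ _)
  have hsplit : ∫ s in a..(a + T), flowIndicator U α c s =
      (∫ s in a..(0 : ℝ), flowIndicator U α c s) + (∫ s in (0 : ℝ)..N, flowIndicator U α c s) +
        ∫ s in (N : ℝ)..(a + T), flowIndicator U α c s := by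
    rw [intervalIntegral.integral_add_adjacent_intervals (hint _ _) (hint _ _),
      intervalIntegral.integral_add_adjacent_intervals (hint _ _) (hint _ _)]
  have hsum : ∫ s in (0 : ℝ)..N, flowIndicator U α c s =
      ∑ k ∈ Finset.range N, returnTime U α (c + k * α) := by
    have := intervalIntegral.sum_integral_adjacent_intervals (a := fun k : ℕ => (k : ℝ)) (n := N)
      (μ := volume) (f := flowIndicator U α c) (fun k _ => hint _ _)
    simp only [integral_flowIndicator_add_nat, Nat.cast_zero] at this
    exact this.symm
  have hCN := hC c N
  rw [Finset.sum_sub_distrib, ← hsum, Finset.sum_const, Finset.card_range, nsmul_eq_mul] at hCN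
  have h1 := abs_integral_flowIndicator_le U α c a 0
  have h2 := abs_integral_flowIndicator_le U α c N (a + T)
  rw [zero_sub, abs_neg, abs_of_nonneg ha.1] at h1
  rw [abs_of_nonneg (a := a + T - N) (by linarith [ha.1])] at h2
  have h3 : |(T - N) * volume.real U| ≤ 1 := by
    rw [abs_mul, abs_of_nonneg (by linarith), abs_of_nonneg measureReal_nonneg]
    have := volume_real_le_one_of_subset hU
    have h0 : (0 : ℝ) ≤ volume.real U := measureReal_nonneg
    nlinarith
  rw [hsplit]
  rw [abs_le] at *
  constructor <;> linarith [h1.1, h1.2, h2.1, h2.2, h3.1, h3.2, hCN.1, hCN.2, ha.1, ha.2]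

/-- The orbit of `x` is the flow line through `(0, x.2 - α * x.1)`, entered at time `x.1`. -/
theorem contRotation_eq (α : ℝ) (x : ℝ × ℝ) (t : ℝ) :
    contRotation α x t =
      (Int.fract (x.1 + t), Int.fract (x.2 - α * x.1 + α * (x.1 + t))) := by
  rw [contRotation]
  ring_nf

theorem countable_setOf_contRotation_mem {B : Set (ℝ × ℝ)} {α : ℝ}
    (hB : ∀ c, {u : ℝ | (u, c + α * u) ∈ B}.Countable) (x : ℝ × ℝ) :
    {t : ℝ | contRotation α x t ∈ B}.Countable := by
  refine (countable_iUnion fun m : ℤ => countable_iUnion fun k : ℤ =>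
    (hB (x.2 - α * x.1 + α * m - k)).preimage
      (f := fun t : ℝ => x.1 + t - m) fun t t' h => by simpa using h).mono fun t ht => ?_
  simp only [mem_iUnion, mem_preimage, mem_ofPred_eq]
  refine ⟨⌊x.1 + t⌋, ⌊x.2 + α * t⌋, ?_⟩
  have : contRotation α x t = (x.1 + t - ⌊x.1 + t⌋, x.2 + α * t - ⌊x.2 + α * t⌋) := rfl
  rw [mem_ofPred_eq, this] at ht
  convert ht using 2
  ring

theorem IsDiophantine.isBoundedRemainderSet {α : ℝ} (hα : IsDiophantine α) {x : ℝ × ℝ}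
    (hx : x ∈ unitSquare) {S : Set (ℝ × ℝ)} (hS : IsPolygonWithoutEdgeOfSlope S α) :
    IsBoundedRemainderSet S α x := by
  obtain ⟨hSsq, n, P, ⟨hP, hUS, hSU⟩, hslope⟩ := hS
  set U := polygonInside P with hUdef
  have hU : U ⊆ unitSquare := hUS.trans hSsq
  have hreg : IsRegionOff (P.boundary ℝ) U := isRegionOff_polygonInside hU
  have hUm : MeasurableSet U := hreg.isOpen.measurableSet
  have hcount := fun c => countable_setOf_line_mem_boundary hP hslope c
  have hcont : Continuous (returnTime U α) :=
    continuous_returnTime hU hUm (hreg.continuous_chordLength hcount)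
  obtain ⟨μ, hμ⟩ := exists_hasBoundedDiscrepancy hα
    (Finset.univ.image fun i => intercept α (P i)) 0 (returnTime U α) hcont
    (returnTime_periodic U α) (fun z hz => isLocallyQuadraticAt_returnTime hU hUm fun k =>
      isLocallyQuadraticAt_chordLength_polygonInside hP hslope hU fun i hi => by
        refine hz (intercept α (P i)) (by simp) k ?_
        linarith)
  rw [hμ.eq_integral hcont (returnTime_periodic U α), integral_returnTime hU hUm] at hμ
  obtain ⟨C, hC⟩ := exists_abs_integral_flowIndicator_sub_le hU hUm hμ
  -- `S` may contain any part of the chain. The chain is null in the plane, and the orbit visits it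
  -- at only countably many times, so `U` can replace `S` both in the area and in the time integral.
  have hSUae : S =ᵐ[volume] U := by
    have hB := measure_eq_zero_iff_ae_notMem.1 (volume_polygon_boundary P)
    filter_upwards [hB] with p hp
    exact propext ⟨fun h => (hSU h).resolve_right hp, fun h => hUS h⟩
  have hflow : ∀ᵐ t : ℝ, S.indicator (fun _ => (1 : ℝ)) (contRotation α x t) =
      flowIndicator U α (x.2 - α * x.1) (x.1 + t) := by
    filter_upwards [(countable_setOf_contRotation_mem hcount x).ae_notMem volume] with t ht
    rw [flowIndicator, ← contRotation_eq]
    by_cases h : contRotation α x t ∈ U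
    · rw [indicator_of_mem h, indicator_of_mem (hUS h)]
    · rw [indicator_of_notMem h, indicator_of_notMem fun h' => h ((hSU h').resolve_right ht)]
  refine ⟨hUm.nullMeasurableSet.congr hSUae.symm, fun T _ => ?_, C, fun T hT => ?_⟩
  · refine (intervalIntegrable_of_measurable_of_norm_le
      ((measurable_flowIndicator hUm α (x.2 - α * x.1)).comp (measurable_const_add x.1))
      (fun s => norm_indicator_one_le _ _) 0 T).congr_ae (ae_restrict_of_ae ?_)
    filter_upwards [hflow] with t ht using ht.symm
  · rw [distributionalError, measureReal_congr hSUae,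
      intervalIntegral.integral_congr_ae (hflow.mono fun t ht _ => ht),
      intervalIntegral.integral_comp_add_left, add_zero]
    exact hC _ _ _ hx.1 hT

end

theorem theorem1 :
    (∀ᵐ α : ℝ ∂volume, 0 < α →
      ∀ x ∈ unitSquare, ∀ S : Set (ℝ × ℝ), IsPolygonWithoutEdgeOfSlope S α →
        IsBoundedRemainderSet S α x) ∧
    (∀ α : ℝ, 0 < α → Irrational α → PartialQuotientCondition α →
      ∀ x ∈ unitSquare, ∀ S : Set (ℝ × ℝ), IsPolygonWithoutEdgeOfSlope S α →
        IsBoundedRemainderSet S α x) :=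
  ⟨ae_isDiophantine.mono fun _ hα _ _ hx _ hS => hα.isBoundedRemainderSet hx hS,
    fun _ _ hirr hcond _ hx _ hS =>
      (isDiophantine_of_partialQuotientCondition hirr hcond).isBoundedRemainderSet hx hS⟩
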